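/- Setting. There are $N\ge 2$ workers on a strongly connected directed graph; $\mathcal N_i$ denotes the set of workers with an edge to $i$, together with $i$ itself. Let $P=(P_{ij})$ be a nonnegative doubly stochastic $N\times N$ matrix with $P_{ij}>0$ exactly when $j\in\mathcal N_i$; put $p=\min\{P_{ij}: P_{ij}>0\}$, $C=\frac{2(1+p^{-N})}{1-p^N}$ and $q=(1-p^N)^{1/N}$. Worker $i$ holds a finite dataset $\mathcal D_i$ and has local loss $F_i(\phi,\theta)=\frac1{|\mathcal D_i|}\sum_{(x,y)\in\mathcal D_i}\ell(\theta\circ\phi;x,y)$, where $\phi\in\mathbb R^a$ and $\theta\in\mathbb R^b$ are the parameter vectors of the shared representation and of the worker's head; each $\ell(\theta\circ\phi;x,y)$ is differentiable in $\phi$ and in $\theta$ separately. Let $f(\phi,\{\theta_i\})=\frac1N\sum_i F_i(\phi,\theta_i)$, $\nabla_\phi f(\phi,\{\theta_i\})=\frac1N\sum_i\nabla_\phi F_i(\phi,\theta_i)$ and $\nabla_\theta f(\phi,\{\theta_i\})=\frac1N\sum_i\nabla_\theta F_i(\phi,\theta_i)$. Algorithm (DePRL). Start from $\phi_i(0)=\phi(0)$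 for all $i$ and heads $\theta_i(0)$ (deterministic). In round $k$, every worker $i$ sets $\theta_i(k,0)=\theta_i(k)$, performs $\theta_i(k,s+1)=\theta_i(k,s)-\alpha\, g_\theta(\phi_i(k),\theta_i(k,s))$ for $s=0,\dots,\tau-1$ (where $\tau\ge1$), sets $\theta_i(k+1)=\theta_i(k,\tau)$, then $\phi_i(k+\tfrac12)=\phi_i(k)-\beta\, g_\phi(\phi_i(k),\theta_i(k+1))$ and $\phi_i(k+1)=\sum_{j\in\mathcal N_i}P_{ij}\,\phi_j(k+\tfrac12)$. Here $g_\theta,g_\phi$ are averages of per-example gradients over random nonempty mini-batches of $\mathcal D_i$, all mini-batches (across workers, rounds and steps) being independent. Assumptions. For constants $L,\sigma,\varsigma>0$: for all $i,\phi,\phi',\theta,\theta'$, both $\|\nabla_\phi F_i(\phi,\theta)-\nabla_\phi F_i(\phi',\theta')\|$ and $\|\nabla_\theta F_i(\phi,\theta)-\nabla_\theta F_i(\phi',\theta')\|$ are at most $L(\|\phi-\phi'\|+\|\theta-\theta'\|)$; for fixed $(\phi,\theta)$ the stochastic gradients $g_\phi,g_\theta$ of worker $i$ have means $\nabla_\phi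 F_i(\phi,\theta)$, $\nabla_\theta F_i(\phi,\theta)$ and variances at most $\sigma^2$; and $\frac1N\sum_i\|\nabla_\phi F_i(\phi,\theta_i)-\nabla_\phi f(\phi,\{\theta_j\})\|^2\le\varsigma^2$ for all $\phi,\{\theta_i\}$. Finally $f^*:=\inf f>-\infty$ and $f(\phi(0),\{\theta_i(0)\})-f^*\le\Delta$. Corollary 1. Let $\alpha=\frac1{\tau\sqrt K}$ and $\beta=\sqrt{N/K}$, and with $\bar\phi(k)=\frac1N\sum_i\phi_i(k)$ let $$M(k)=\|\nabla_\phi f(\bar\phi(k),\{\theta_i(k+1)\})\|^2+\frac{\alpha\tau}{\beta}\|\nabla_\theta f(\bar\phi(k),\{\theta_i(k)\})\|^2+\frac1N\sum_{i=1}^N\|\phi_i(k)-\bar\phi(k)\|^2 .$$ There is a constant $c>0$ depending only on $L,\sigma,\varsigma,\Delta$ such that, whenever $$K\ge\max\left(\frac{18C^2L^2N^3}{(1-q)^2},\ \frac{(2L^2+2)^2}{NL^4},\ NL^2\right),$$ each $M(k)$, $k<K$, is integrable and $$\frac1K\sum_{k=0}^{K-1}\mathbb E[M(k)]\le c\left(\frac1{\sqrt{NK}}+\frac1{K\sqrt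 N}+\frac1{\tau\sqrt{NK}}\right).$$ In particular the left-hand side is at most $3c/\sqrt{NK}$ with $c$ independent of $N$, that is, there is a linear speedup in the number of workers. -/

import Mathlib

open MeasureTheory ProbabilityTheory

noncomputable section

namespace DePRL

/-- Parameter vectors, with the Euclidean norm. -/
abbrev Vec (n : ℕ) : Type := EuclideanSpace ℝ (Fin n)

/-- A personalized learning problem with `N` workers. The global representation, with parameter in
`ℝ^a`, maps inputs `X` to features `Z`; a local head, with parameter in `ℝ^b`, maps features to
predictions `W`; `err` compares a prediction with a label in `Y`. Worker `i` holds the finite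
dataset `data i` of `size i` examples. -/
structure Problem (N a b : ℕ) (X Z W Y : Type*) where
  rep : Vec a → X → Z
  head : Vec b → Z → W
  err : W → Y → ℝ
  size : Fin N → ℕ
  data : (i : Fin N) → Fin (size i) → X × Y

namespace Problem

variable {N a b : ℕ} {X Z W Y : Type*} (Q : Problem N a b X Z W Y)

/-- The error of the model `θ ∘ φ` on the `m`-th example of worker `i`. -/
def sampleLoss (i : Fin N) (m : Fin (Q.size i)) (φ : Vec a) (θ : Vec b) : ℝ :=
  Q.err ((Q.head θ ∘ Q.rep φ) (Q.data i m).1) (Q.data i m).2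

/-- The local loss `F_i(φ, θ)`: average over the dataset of worker `i`. -/
def localLoss (i : Fin N) (φ : Vec a) (θ : Vec b) : ℝ :=
  (1 / (Q.size i : ℝ)) * ∑ m, Q.sampleLoss i m φ θ

/-- The global loss `f(φ, {θ_i}) = (1/N) ∑ F_i(φ, θ_i)`. -/
def globalLoss (φ : Vec a) (θ : Fin N → Vec b) : ℝ :=
  (1 / (N : ℝ)) * ∑ i, Q.localLoss i φ (θ i)

/-- `∇_φ F_i(φ, θ)`. -/
def gradRep (i : Fin N) (φ : Vec a) (θ : Vec b) : Vec a :=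
  gradient (fun φ' => Q.localLoss i φ' θ) φ

/-- `∇_θ F_i(φ, θ)`. -/
def gradHead (i : Fin N) (φ : Vec a) (θ : Vec b) : Vec b :=
  gradient (fun θ' => Q.localLoss i φ θ') θ

/-- `∇_φ f(φ, {θ_i}) = (1/N) ∑ ∇_φ F_i(φ, θ_i)`. -/
def globalGradRep (φ : Vec a) (θ : Fin N → Vec b) : Vec a :=
  (1 / (N : ℝ)) • ∑ i, Q.gradRep i φ (θ i)

/-- `∇_θ f(φ, {θ_i}) = (1/N) ∑ ∇_θ F_i(φ, θ_i)`. -/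
def globalGradHead (φ : Vec a) (θ : Fin N → Vec b) : Vec b :=
  (1 / (N : ℝ)) • ∑ i, Q.gradHead i φ (θ i)

/-- Stochastic gradient `g_φ` of worker `i` on the mini-batch `B`. -/
def batchGradRep (i : Fin N) (B : Finset (Fin (Q.size i))) (φ : Vec a) (θ : Vec b) : Vec a :=
  (1 / (B.card : ℝ)) • ∑ m ∈ B, gradient (fun φ' => Q.sampleLoss i m φ' θ) φ

/-- Stochastic gradient `g_θ` of worker `i` on the mini-batch `B`. -/
def batchGradHead (i : Fin N) (B : Finset (Fin (Q.size i))) (φ : Vec a) (θ : Vec b) : Vec b :=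
  (1 / (B.card : ℝ)) • ∑ m ∈ B, gradient (fun θ' => Q.sampleLoss i m φ θ') θ

/-- Each per-example loss has partial gradients in `φ` and in `θ` everywhere. -/
def PartiallyDifferentiable : Prop :=
  (∀ i m θ, Differentiable ℝ fun φ => Q.sampleLoss i m φ θ) ∧
  (∀ i m φ, Differentiable ℝ fun θ => Q.sampleLoss i m φ θ)

/-- `L`-Lipschitz partial gradients of every local loss. -/
def LipschitzGradients (L : ℝ) : Prop :=
  (∀ i φ φ' θ θ', ‖Q.gradRep i φ θ - Q.gradRep i φ' θ'‖ ≤ L * (‖φ - φ'‖ + ‖θ - θ'‖)) ∧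
  (∀ i φ φ' θ θ', ‖Q.gradHead i φ θ - Q.gradHead i φ' θ'‖ ≤ L * (‖φ - φ'‖ + ‖θ - θ'‖))

/-- Global variability of the local partial gradients in `φ` bounded by `ς²`. -/
def BoundedVariability (ς : ℝ) : Prop :=
  ∀ (φ : Vec a) (θ : Fin N → Vec b),
    (1 / (N : ℝ)) * ∑ i, ‖Q.gradRep i φ (θ i) - Q.globalGradRep φ θ‖ ^ 2 ≤ ς ^ 2

end Problem

/-- The random mini-batches: `headBatch i k s` is used by worker `i` in the local head step `s` of
round `k`, and `repBatch i k` in its representation step of round `k`. -/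
structure Batches {N a b : ℕ} {X Z W Y : Type*} (Q : Problem N a b X Z W Y) (Ω : Type*) where
  headBatch : (i : Fin N) → ℕ → ℕ → Ω → Finset (Fin (Q.size i))
  repBatch : (i : Fin N) → ℕ → Ω → Finset (Fin (Q.size i))

namespace Batches

variable {N a b : ℕ} {X Z W Y Ω : Type*} {Q : Problem N a b X Z W Y} (S : Batches Q Ω)

/-- All mini-batches as one family: worker, round, and local head step or (for `none`) the
representation step. -/
def family (τ : ℕ) : (j : Fin N × ℕ × Option (Fin τ)) → Ω → Finset (Fin (Q.size j.1))
  | (i, k, some s) => S.headBatch i k s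
  | (i, k, none) => S.repBatch i k

/-- The mini-batches are nonempty random subsets of the datasets, sampled independently across
workers, rounds and steps. -/
structure IsIndependentSampling [MeasurableSpace Ω] (μ : Measure Ω) (τ : ℕ) : Prop where
  measurable : ∀ j, Measurable[_, ⊤] (S.family τ j)
  nonempty : ∀ j ω, (S.family τ j ω).Nonempty
  indep : iIndepFun (m := fun _ => ⊤) (S.family τ) μ

/-- Unbiased stochastic gradients. -/
def Unbiased [MeasurableSpace Ω] (μ : Measure Ω) (τ : ℕ) : Prop :=
  (∀ i k φ θ, ∫ ω, Q.batchGradRep i (S.repBatch i k ω) φ θ ∂μ = Q.gradRep i φ θ) ∧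
  (∀ i k, ∀ s < τ, ∀ φ θ,
    ∫ ω, Q.batchGradHead i (S.headBatch i k s ω) φ θ ∂μ = Q.gradHead i φ θ)

/-- Variance of the stochastic gradients bounded by `σ²`. -/
def BoundedVariance [MeasurableSpace Ω] (μ : Measure Ω) (τ : ℕ) (σ : ℝ) : Prop :=
  (∀ i k φ θ,
    ∫ ω, ‖Q.batchGradRep i (S.repBatch i k ω) φ θ - Q.gradRep i φ θ‖ ^ 2 ∂μ ≤ σ ^ 2) ∧
  (∀ i k, ∀ s < τ, ∀ φ θ,
    ∫ ω, ‖Q.batchGradHead i (S.headBatch i k s ω) φ θ - Q.gradHead i φ θ‖ ^ 2 ∂μ ≤ σ ^ 2)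

end Batches

open Classical in
/-- The neighbours of worker `i`: those with an edge to `i`, and `i` itself. -/
def neighbors {N : ℕ} (G : Digraph (Fin N)) (i : Fin N) : Finset (Fin N) :=
  Finset.univ.filter fun j => G.Adj j i ∨ j = i

/-- There is a directed path between any two workers. -/
def StronglyConnected {N : ℕ} (G : Digraph (Fin N)) : Prop :=
  ∀ i j, Relation.ReflTransGen G.Adj i j

/-- A consensus matrix for `G`: (nonnegative and) doubly stochastic, with positive weights exactly
on the neighbours. -/
structure IsConsensusMatrix {N : ℕ} (G : Digraph (Fin N)) (P : Matrix (Fin N) (Fin N) ℝ) :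
    Prop where
  doublyStochastic : P ∈ doublyStochastic ℝ (Fin N)
  pos_iff : ∀ i j, 0 < P i j ↔ j ∈ neighbors G i

/-- `p`, the smallest positive entry of the consensus matrix. -/
def minWeight {N : ℕ} (P : Matrix (Fin N) (Fin N) ℝ) : ℝ :=
  sInf {x | 0 < x ∧ ∃ i j, P i j = x}

/-- `C = 2 (1 + p^{-N}) / (1 - p^N)`. -/
def constC {N : ℕ} (P : Matrix (Fin N) (Fin N) ℝ) : ℝ :=
  2 * (1 + (minWeight P ^ N)⁻¹) / (1 - minWeight P ^ N)

/-- `q = (1 - p^N)^{1/N}`. -/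
def constQ {N : ℕ} (P : Matrix (Fin N) (Fin N) ℝ) : ℝ :=
  (1 - minWeight P ^ N) ^ (1 / (N : ℝ))

section Algorithm

variable {N a b : ℕ} {X Z W Y Ω : Type*} (Q : Problem N a b X Z W Y) (S : Batches Q Ω)
  (G : Digraph (Fin N)) (P : Matrix (Fin N) (Fin N) ℝ) (α β : ℝ) (τ : ℕ)
  (φ₀ : Vec a) (θ₀ : Fin N → Vec b)

/-- Local head updates of worker `i` in round `k`: the iterates `θ_i(k, s)`, `s = 0, 1, …`, started
at `θ`, with the representation `φ` fixed. -/
def headIterate (i : Fin N) (k : ℕ) (ω : Ω) (φ : Vec a) (θ : Vec b) : ℕ → Vec b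
  | 0 => θ
  | s + 1 =>
    headIterate i k ω φ θ s -
      α • Q.batchGradHead i (S.headBatch i k s ω) φ (headIterate i k ω φ θ s)

/-- The parameters `({φ_i(k)}, {θ_i(k)})` at the start of round `k`. -/
def iterate (ω : Ω) : ℕ → (Fin N → Vec a) × (Fin N → Vec b)
  | 0 => (fun _ => φ₀, θ₀)
  | k + 1 =>
    let φ := (iterate ω k).1
    let θ := (iterate ω k).2
    let θ' : Fin N → Vec b := fun i => headIterate Q S α i k ω (φ i) (θ i) τ
    let φHalf : Fin N → Vec a := fun i =>
      φ i - β • Q.batchGradRep i (S.repBatch i k ω) (φ i) (θ' i)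
    (fun i => ∑ j ∈ neighbors G i, P i j • φHalf j, θ')

/-- `φ_i(k)`. -/
def repAt (k : ℕ) (ω : Ω) (i : Fin N) : Vec a :=
  (iterate Q S G P α β τ φ₀ θ₀ ω k).1 i

/-- `θ_i(k)`. -/
def headAt (k : ℕ) (ω : Ω) (i : Fin N) : Vec b :=
  (iterate Q S G P α β τ φ₀ θ₀ ω k).2 i

/-- The average `\bar φ(k)` of the representations. -/
def meanRep (k : ℕ) (ω : Ω) : Vec a :=
  (1 / (N : ℝ)) • ∑ i, repAt Q S G P α β τ φ₀ θ₀ k ω i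

/-- The convergence measure `M(k)`. -/
def measureM (k : ℕ) (ω : Ω) : ℝ :=
  ‖Q.globalGradRep (meanRep Q S G P α β τ φ₀ θ₀ k ω)
      (headAt Q S G P α β τ φ₀ θ₀ (k + 1) ω)‖ ^ 2
  + α * τ / β * ‖Q.globalGradHead (meanRep Q S G P α β τ φ₀ θ₀ k ω)
      (headAt Q S G P α β τ φ₀ θ₀ k ω)‖ ^ 2
  + (1 / (N : ℝ)) *
      ∑ i, ‖repAt Q S G P α β τ φ₀ θ₀ k ω i - meanRep Q S G P α β τ φ₀ θ₀ k ω‖ ^ 2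

/-- `(1/K) ∑_{k < K} E[M(k)]`. -/
def averageM [MeasurableSpace Ω] (μ : Measure Ω) (K : ℕ) : ℝ :=
  (1 / (K : ℝ)) * ∑ k ∈ Finset.range K, ∫ ω, measureM Q S G P α β τ φ₀ θ₀ k ω ∂μ

end Algorithm

end DePRL

end

open MeasureTheory ProbabilityTheory

noncomputable section

/-! The loss at the averaged representation φ̄(k) and the current heads is a Lyapunov function. In
each round the heads move first, with the representations frozen; then φ̄ takes one step along the
mean of the workers' stochastic gradients, because a doubly stochastic `P` preserves means. The
descent inequality for each half (`integral_localLoss_headIterate_le`,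
`integral_globalLoss_rep_step_le`) yields an expected decrease by multiples of the two squared
gradients in M(k). The errors are sampling noise and L² times the dispersion of the φ_i, the latter
because workers differentiate at φ_i and not at φ̄. The speedup comes from `integral_avg_noise`:
independent centred noises of N workers average to variance at most σ²/N, which pays for the larger
step β = √(N/K).

The dispersion is controlled by `IsConsensusMatrix.contraction`. A mixing step loses energy across
every edge; if the loss is small, neighbours agree, and so do all workers, along paths with fewer
than N edges. This gives a spectral gap of at least 2p²/N³, hence at least p^N/8. The dispersion
then stays below a multiple of β²/gap² (`le_of_contraction`). Since 1/gap² is at most 32 C/(1-q),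
the lower bound on K turns this into O(1/√(NK)), with a constant free of N and `P`.

Mini-batches take finitely many values, so anything determined by finitely many of them is
integrable, and conditioning on the past reduces to freezing an independent argument
(`DeterminedBy.integral_eq`). -/

namespace DePRL

/-! ### Functions of finitely many independent finite-valued variables -/

section Determined

variable {Ω ι A B E : Type*} {κ : ι → Type*} {Y : ∀ j, Ω → κ j} {T T' : Finset ι}

/-- `X` is a function of the random variables `Y j`, `j ∈ T`. -/
def DeterminedBy (Y : ∀ j, Ω → κ j) (T : Finset ι) (X : Ω → A) : Prop :=
  ∀ ω ω', (∀ j ∈ T, Y j ω = Y j ω') → X ω = X ω'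

namespace DeterminedBy

lemma mono {X : Ω → A} (h : DeterminedBy Y T X) (hT : T ⊆ T') : DeterminedBy Y T' X :=
  fun ω ω' hω => h ω ω' fun j hj => hω j (hT hj)

lemma self {j : ι} (hj : j ∈ T) : DeterminedBy Y T (Y j) := fun _ _ h => h j hj

lemma comp {X : Ω → A} (h : DeterminedBy Y T X) (f : A → B) :
    DeterminedBy Y T fun ω => f (X ω) := fun ω ω' hω => congrArg f (h ω ω' hω)

lemma comp₂ {C : Type*} {X : Ω → A} {X' : Ω → B} (h : DeterminedBy Y T X)
    (h' : DeterminedBy Y T X') (f : A → B → C) : DeterminedBy Y T fun ω => f (X ω) (X' ω) :=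
  fun ω ω' hω => congrArg₂ f (h ω ω' hω) (h' ω ω' hω)

lemma pi {α : Type*} {X : α → Ω → A} (h : ∀ i, DeterminedBy Y T (X i)) :
    DeterminedBy Y T fun ω i => X i ω := fun ω ω' hω => funext fun i => h i ω ω' hω

lemma exists_eq_comp {X : Ω → A} [Nonempty A] (h : DeterminedBy Y T X) :
    ∃ Φ : (∀ j : T, κ j) → A, ∀ ω, X ω = Φ fun j => Y j ω := by
  classical
  have hf : Function.FactorsThrough X (fun ω (j : T) => Y j ω) := by
    intro ω ω' hω
    exact h ω ω' fun j hj => congrFun hω ⟨j, hj⟩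
  refine ⟨Function.extend (fun ω (j : T) => Y j ω) X fun _ => Classical.arbitrary A, fun ω => ?_⟩
  exact (hf.extend_apply _ ω).symm

variable [MeasurableSpace Ω] {μ : Measure Ω}

/-- `X` factors through a finite product of finite discrete spaces, on which every function is
integrable for a finite measure. No measurability of losses or gradients is ever needed. -/
lemma integrable [∀ j, Finite (κ j)] [IsFiniteMeasure μ] [NormedAddCommGroup E] {X : Ω → E}
    (h : DeterminedBy Y T X) (hY : ∀ j, Measurable[_, ⊤] (Y j)) : Integrable X μ := by
  let _ : ∀ j, MeasurableSpace (κ j) := fun _ => ⊤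
  obtain ⟨Φ, hΦ⟩ := h.exists_eq_comp
  have hZ : Measurable fun ω (j : T) => Y j ω := measurable_pi_lambda _ fun j => hY j
  have : X = Φ ∘ fun ω (j : T) => Y j ω := funext hΦ
  rw [this]
  exact (Integrable.of_finite (f := Φ)).comp_measurable hZ

/-- The freezing lemma, standing in for conditional expectation: as `j ∉ T`, the joint law of the
past and `Y j` is a product, and Fubini applies. -/
lemma integral_eq [∀ j, Finite (κ j)] [IsProbabilityMeasure μ] {X : Ω → A}
    (h : DeterminedBy Y T X) (hY : ∀ j, Measurable[_, ⊤] (Y j))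
    (hind : iIndepFun (m := fun _ => ⊤) Y μ) {j : ι} (hj : j ∉ T) (g : A → κ j → ℝ) :
    ∫ ω, g (X ω) (Y j ω) ∂μ = ∫ ω, ∫ ω', g (X ω) (Y j ω') ∂μ ∂μ := by
  let _ : ∀ j, MeasurableSpace (κ j) := fun _ => ⊤
  have _ : Nonempty Ω := μ.nonempty_of_neZero
  have : Nonempty A := ⟨X (Classical.arbitrary Ω)⟩
  obtain ⟨Φ, hΦ⟩ := h.exists_eq_comp
  have hZ : Measurable fun ω (j : T) => Y j ω := measurable_pi_lambda _ fun j => hY j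
  have hYj : Measurable (Y j) := hY j
  have hi : IndepFun (fun ω (j : T) => Y j ω) (Y j) μ := by
    have h1 := hind.indepFun_finset T {j} (by simpa using hj) hY
    have h2 : Measurable fun z : ∀ i : ({j} : Finset ι), κ i => z ⟨j, Finset.mem_singleton_self j⟩ :=
      measurable_pi_apply _
    exact h1.comp measurable_id h2
  rw [indepFun_iff_map_prod_eq_prod_map_map hZ.aemeasurable hYj.aemeasurable] at hi
  have := Measure.isProbabilityMeasure_map (μ := μ) hZ.aemeasurable
  have := Measure.isProbabilityMeasure_map (μ := μ) hYj.aemeasurable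
  simp only [hΦ]
  have hG : Integrable (fun z : (∀ j : T, κ j) × κ j => g (Φ z.1) z.2)
      ((μ.map fun ω (j : T) => Y j ω).prod (μ.map (Y j))) := Integrable.of_finite
  have e1 := integral_map (μ := μ) (hZ.prodMk hYj).aemeasurable
    (f := fun z : (∀ j : T, κ j) × κ j => g (Φ z.1) z.2) (by rw [hi]; exact hG.1)
  rw [hi, integral_prod _ hG] at e1
  rw [← e1]
  rw [integral_map hZ.aemeasurable (Integrable.of_finite).1]
  refine integral_congr_ae (Filter.Eventually.of_forall fun ω => ?_)
  exact integral_map hYj.aemeasurable (Integrable.of_finite).1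

lemma integral_le [∀ j, Finite (κ j)] [IsProbabilityMeasure μ] {X : Ω → A}
    (h : DeterminedBy Y T X) (hY : ∀ j, Measurable[_, ⊤] (Y j))
    (hind : iIndepFun (m := fun _ => ⊤) Y μ) {j : ι} (hj : j ∉ T) (g : A → κ j → ℝ) {M : ℝ}
    (hM : ∀ x, ∫ ω, g x (Y j ω) ∂μ ≤ M) : ∫ ω, g (X ω) (Y j ω) ∂μ ≤ M := by
  rw [h.integral_eq hY hind hj]
  calc _ ≤ ∫ _, M ∂μ := integral_mono ((h.comp fun x => ∫ ω', g x (Y j ω') ∂μ).integrable hY)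
        (integrable_const _) fun ω => hM _
    _ = M := by simp

variable [NormedAddCommGroup E] [InnerProductSpace ℝ E] [CompleteSpace E]

lemma integral_inner_eq [∀ j, Finite (κ j)] [IsProbabilityMeasure μ] {X : Ω → A}
    (h : DeterminedBy Y T X) (hY : ∀ j, Measurable[_, ⊤] (Y j))
    (hind : iIndepFun (m := fun _ => ⊤) Y μ) {j : ι} (hj : j ∉ T) (u : A → E) (g : A → κ j → E)
    {m : A → E} (hm : ∀ x, ∫ ω, g x (Y j ω) ∂μ = m x) :
    ∫ ω, inner ℝ (u (X ω)) (g (X ω) (Y j ω)) ∂μ = ∫ ω, inner ℝ (u (X ω)) (m (X ω)) ∂μ := by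
  rw [h.integral_eq hY hind hj fun x y => inner ℝ (u x) (g x y)]
  refine integral_congr_ae (Filter.Eventually.of_forall fun ω => ?_)
  have hi : Integrable (fun ω' => g (X ω) (Y j ω')) μ :=
    ((self (Y := Y) (Finset.mem_singleton_self j)).comp fun y => g (X ω) y).integrable hY
  simp only [integral_inner hi, hm]

/-- Bias-variance decomposition about the conditional mean `m (X ω)`; the cross term is evaluated by
`integral_inner_eq`. -/
lemma integral_norm_sq_le [∀ j, Finite (κ j)] [IsProbabilityMeasure μ] {X : Ω → A}
    (h : DeterminedBy Y T X) (hY : ∀ j, Measurable[_, ⊤] (Y j))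
    (hind : iIndepFun (m := fun _ => ⊤) Y μ) {j : ι} (hj : j ∉ T) (g : A → κ j → E)
    {m : A → E} (hm : ∀ x, ∫ ω, g x (Y j ω) ∂μ = m x) {v : ℝ}
    (hv : ∀ x, ∫ ω, ‖g x (Y j ω) - m x‖ ^ 2 ∂μ ≤ v) :
    ∫ ω, ‖g (X ω) (Y j ω)‖ ^ 2 ∂μ ≤ ∫ ω, ‖m (X ω)‖ ^ 2 ∂μ + v := by
  classical
  have h' : DeterminedBy Y (insert j T) X := h.mono (Finset.subset_insert _ _)
  have hj' : DeterminedBy Y (insert j T) (Y j) := self (Finset.mem_insert_self _ _)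
  have key : ∀ ω, ‖g (X ω) (Y j ω)‖ ^ 2 = ‖g (X ω) (Y j ω) - m (X ω)‖ ^ 2
      + (2 * inner ℝ (m (X ω)) (g (X ω) (Y j ω)) - ‖m (X ω)‖ ^ 2) := fun ω => by
    rw [norm_sub_sq_real, real_inner_comm]; ring
  have e := h.integral_inner_eq hY hind hj m g hm
  simp only [real_inner_self_eq_norm_sq] at e
  simp only [key]
  rw [integral_add ((h'.comp₂ hj' fun x y => ‖g x y - m x‖ ^ 2).integrable hY)
      ((h'.comp₂ hj' fun x y => 2 * inner ℝ (m x) (g x y) - ‖m x‖ ^ 2).integrable hY),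
    integral_sub ((h'.comp₂ hj' fun x y => 2 * inner ℝ (m x) (g x y)).integrable hY)
      ((h'.comp fun x => ‖m x‖ ^ 2).integrable hY), integral_const_mul, e]
  have := h.integral_le hY hind hj (fun x y => ‖g x y - m x‖ ^ 2) hv
  linarith

end DeterminedBy

end Determined

/-! ### Norm inequalities and propagation along paths -/

section Norm

variable {E : Type*} [NormedAddCommGroup E]

lemma norm_sum_sq_le {ι : Type*} (s : Finset ι) (x : ι → E) :
    ‖∑ i ∈ s, x i‖ ^ 2 ≤ s.card * ∑ i ∈ s, ‖x i‖ ^ 2 :=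
  (pow_le_pow_left₀ (norm_nonneg _) (norm_sum_le _ _) 2).trans sq_sum_le_card_mul_sum_sq

lemma norm_add_three_sq_le (x y z : E) :
    ‖x + y + z‖ ^ 2 ≤ 3 * (‖x‖ ^ 2 + ‖y‖ ^ 2 + ‖z‖ ^ 2) := by
  have h := norm_add₃_le (a := x) (b := y) (c := z)
  nlinarith [sq_nonneg (‖x‖ - ‖y‖), sq_nonneg (‖y‖ - ‖z‖), sq_nonneg (‖x‖ - ‖z‖),
    norm_nonneg (x + y + z), norm_nonneg x, norm_nonneg y, norm_nonneg z]

lemma norm_sub_sq_le_young {η : ℝ} (hη : 0 < η) (x y : E) :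
    ‖x - y‖ ^ 2 ≤ (1 + η) * ‖x‖ ^ 2 + (1 + 1 / η) * ‖y‖ ^ 2 := by
  have h := norm_sub_le x y
  have h2 : 2 * ‖x‖ * ‖y‖ ≤ η * ‖x‖ ^ 2 + 1 / η * ‖y‖ ^ 2 := by
    have : η * ‖x‖ ^ 2 + 1 / η * ‖y‖ ^ 2 - 2 * ‖x‖ * ‖y‖ = 1 / η * (η * ‖x‖ - ‖y‖) ^ 2 := by
      field_simp; ring
    have : 0 ≤ 1 / η * (η * ‖x‖ - ‖y‖) ^ 2 := by positivity
    linarith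
  nlinarith [norm_nonneg (x - y), norm_nonneg x, norm_nonneg y]

/-- The bound on edges is symmetric, so directions may be forgotten; a path without repeated
vertices has fewer than `N` edges, and the triangle inequality adds them up. -/
lemma norm_sub_le_of_stronglyConnected {N : ℕ} {G : Digraph (Fin N)}
    (hG : StronglyConnected G) (x : Fin N → E) {m : ℝ}
    (hm0 : 0 ≤ m) (hm : ∀ i j, G.Adj i j → ‖x i - x j‖ ≤ m) (i j : Fin N) :
    ‖x i - x j‖ ≤ N * m := by
  classical
  let H : SimpleGraph (Fin N) := SimpleGraph.fromRel G.Adj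
  have hadj : ∀ i j, H.Adj i j → ‖x i - x j‖ ≤ m := by
    intro i j h
    rcases h with ⟨-, h | h⟩
    · exact hm i j h
    · rw [norm_sub_rev]; exact hm j i h
  have hreach : H.Reachable i j := by
    induction hG i j with
    | refl => rfl
    | tail _ h ih =>
      rename_i b c _
      by_cases hbc : b = c
      · exact hbc ▸ ih
      · exact ih.trans (SimpleGraph.Adj.reachable (G := H) ⟨hbc, Or.inl h⟩)
  obtain ⟨w⟩ := hreach
  have hw : ∀ {i j : Fin N} (w : H.Walk i j), ‖x i - x j‖ ≤ w.length * m := by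
    intro i j w
    induction w with
    | nil => simp
    | cons h w ih =>
      rename_i u v z
      have := norm_sub_le_norm_sub_add_norm_sub (x u) (x v) (x z)
      have := hadj _ _ h
      push_cast [SimpleGraph.Walk.length_cons]
      linarith
  have hlen := w.toPath.2.length_lt
  rw [Fintype.card_fin] at hlen
  refine (hw w.toPath.1).trans ?_
  gcongr

end Norm

/-! ### Descent inequality, means and dispersion -/

section Smooth

variable {E : Type*} [NormedAddCommGroup E] [InnerProductSpace ℝ E]

/-- Along the segment, `f` minus its linear part and the quadratic `L / 2 * ‖d‖ ^ 2 * t ^ 2` has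
nonpositive derivative; compare its values at 0 and 1. -/
lemma le_quadratic_of_lipschitz_gradient [CompleteSpace E] {f : E → ℝ} (hf : Differentiable ℝ f)
    {L : ℝ} (hL : ∀ x y, ‖gradient f x - gradient f y‖ ≤ L * ‖x - y‖) (x y : E) :
    f y ≤ f x + inner ℝ (gradient f x) (y - x) + L / 2 * ‖y - x‖ ^ 2 := by
  set d := y - x
  have hd : ∀ t : ℝ, HasDerivAt
      (fun t : ℝ => f (x + t • d) - t * inner ℝ (gradient f x) d - L / 2 * ‖d‖ ^ 2 * t ^ 2)
      (inner ℝ (gradient f (x + t • d)) d - inner ℝ (gradient f x) d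
        - L * ‖d‖ ^ 2 * t) t := by
    intro t
    have h1 : HasDerivAt (fun t : ℝ => x + t • d) d t := by
      simpa using ((hasDerivAt_id t).smul_const d).const_add x
    have h2 := (hf (x + t • d)).hasGradientAt.hasFDerivAt.comp_hasDerivAt t h1
    have h3 := (hasDerivAt_id t).mul_const (inner ℝ (gradient f x) d)
    have h4 := ((hasDerivAt_id t).pow 2).const_mul (L / 2 * ‖d‖ ^ 2)
    refine ((h2.sub h3).sub h4).congr_deriv ?_
    simp only [InnerProductSpace.toDual_apply_apply, id_eq, one_mul]
    ring
  have hanti : AntitoneOn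
      (fun t : ℝ => f (x + t • d) - t * inner ℝ (gradient f x) d - L / 2 * ‖d‖ ^ 2 * t ^ 2)
      (Set.Icc 0 1) := by
    refine antitoneOn_of_deriv_nonpos (convex_Icc 0 1)
      (fun t _ => (hd t).continuousAt.continuousWithinAt)
      (fun t _ => (hd t).differentiableAt.differentiableWithinAt) fun t ht => ?_
    rw [interior_Icc] at ht
    rw [(hd t).deriv, ← inner_sub_left]
    have h1 := real_inner_le_norm (gradient f (x + t • d) - gradient f x) d
    have h2 := hL (x + t • d) x
    rw [add_sub_cancel_left, norm_smul, Real.norm_of_nonneg ht.1.le] at h2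
    nlinarith [mul_le_mul_of_nonneg_right h2 (norm_nonneg d)]
  have := hanti (Set.left_mem_Icc.2 zero_le_one) (Set.right_mem_Icc.2 zero_le_one) zero_le_one
  simp only [one_smul, one_mul, one_pow, mul_one, zero_smul, zero_mul, add_zero, sub_zero, ne_eq,
    OfNat.ofNat_ne_zero, not_false_eq_true, zero_pow, mul_zero] at this
  have e : x + d = y := add_sub_cancel x y
  rw [e] at this
  linarith [this]

/-- The mean of a family of vectors. -/
def avg {N : ℕ} (x : Fin N → E) : E := (1 / (N : ℝ)) • ∑ i, x i

lemma sum_sub_avg {N : ℕ} (x : Fin N → E) : ∑ i, (x i - avg x) = 0 := by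
  rcases Nat.eq_zero_or_pos N with rfl | hN
  · simp
  have : (N : ℝ) ≠ 0 := by positivity
  simp only [avg, Finset.sum_sub_distrib, Finset.sum_const, Finset.card_univ, Fintype.card_fin,
    ← Nat.cast_smul_eq_nsmul ℝ, smul_smul]
  rw [mul_one_div_cancel this, one_smul, sub_self]

/-- The mean minimises the sum of squared distances. This lets the spread of stochastic gradients be
measured from the global gradient. -/
lemma sum_norm_sub_avg_sq_le {N : ℕ} (x : Fin N → E) (v : E) :
    ∑ i, ‖x i - avg x‖ ^ 2 ≤ ∑ i, ‖x i - v‖ ^ 2 := by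
  have key : ∀ i, ‖x i - v‖ ^ 2 = ‖x i - avg x‖ ^ 2 + 2 * inner ℝ (x i - avg x) (avg x - v)
      + ‖avg x - v‖ ^ 2 := fun i => by
    rw [← norm_add_sq_real]; congr 2; abel
  simp only [key, Finset.sum_add_distrib, ← Finset.mul_sum, ← sum_inner, sum_sub_avg]
  simp only [inner_zero_left, mul_zero, add_zero]
  have : 0 ≤ ∑ _i : Fin N, ‖avg x - v‖ ^ 2 := Finset.sum_nonneg fun _ _ => sq_nonneg _
  linarith

lemma norm_avg_sq_le {N : ℕ} (x : Fin N → E) :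
    ‖avg x‖ ^ 2 ≤ (1 / (N : ℝ)) * ∑ i, ‖x i‖ ^ 2 := by
  rcases Nat.eq_zero_or_pos N with rfl | hN
  · simp [avg]
  have hN' : (0 : ℝ) < N := by positivity
  have h := norm_sum_sq_le Finset.univ x
  rw [avg, norm_smul, mul_pow, Real.norm_of_nonneg (by positivity)]
  calc (1 / (N : ℝ)) ^ 2 * ‖∑ i, x i‖ ^ 2
      ≤ (1 / (N : ℝ)) ^ 2 * (N * ∑ i, ‖x i‖ ^ 2) := by
        gcongr; simpa using h
    _ = _ := by field_simp

/-- Dispersion of a family of vectors around its mean. -/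
def dispersion {N : ℕ} (x : Fin N → E) : ℝ := (1 / (N : ℝ)) * ∑ i, ‖x i - avg x‖ ^ 2

lemma dispersion_nonneg {N : ℕ} (x : Fin N → E) : 0 ≤ dispersion x := by
  unfold dispersion; positivity

end Smooth

/-! ### Spectral gap of the consensus matrix -/

section Consensus

variable {E : Type*} [NormedAddCommGroup E] [InnerProductSpace ℝ E] {N : ℕ}

/-- The exact defect in Jensen's inequality for the squared norm: what averaging loses is the
weighted sum of pairwise distances. -/
lemma norm_sum_smul_sq {w : Fin N → ℝ} (hw : ∑ j, w j = 1) (x : Fin N → E) :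
    ‖∑ j, w j • x j‖ ^ 2 = ∑ j, w j * ‖x j‖ ^ 2
      - 1 / 2 * ∑ j, ∑ l, w j * w l * ‖x j - x l‖ ^ 2 := by
  have h1 : ‖∑ j, w j • x j‖ ^ 2 = ∑ j, ∑ l, w j * w l * inner ℝ (x j) (x l) := by
    rw [← real_inner_self_eq_norm_sq, sum_inner]
    refine Finset.sum_congr rfl fun j _ => ?_
    rw [inner_sum]
    refine Finset.sum_congr rfl fun l _ => ?_
    rw [real_inner_smul_left, real_inner_smul_right]; ring
  have h2 : ∑ j, ∑ l, w j * w l * ‖x j‖ ^ 2 = ∑ j, w j * ‖x j‖ ^ 2 := by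
    refine Finset.sum_congr rfl fun j _ => ?_
    rw [← Finset.sum_mul, ← Finset.mul_sum, hw, mul_one]
  have h3 : ∑ j, ∑ l, w j * w l * ‖x l‖ ^ 2 = ∑ j, w j * ‖x j‖ ^ 2 := by
    rw [← h2, Finset.sum_comm]
    refine Finset.sum_congr rfl fun j _ => Finset.sum_congr rfl fun l _ => ?_
    ring
  have h4 : ∑ j, ∑ l, w j * w l * ‖x j - x l‖ ^ 2 = ∑ j, ∑ l, w j * w l * ‖x j‖ ^ 2
      - 2 * ∑ j, ∑ l, w j * w l * inner ℝ (x j) (x l) + ∑ j, ∑ l, w j * w l * ‖x l‖ ^ 2 := by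
    simp only [Finset.mul_sum, ← Finset.sum_sub_distrib, ← Finset.sum_add_distrib]
    refine Finset.sum_congr rfl fun j _ => Finset.sum_congr rfl fun l _ => ?_
    rw [norm_sub_sq_real]; ring
  rw [h4, h2, h3, h1]; ring

variable {G : Digraph (Fin N)} {P : Matrix (Fin N) (Fin N) ℝ}

lemma IsConsensusMatrix.nonneg (hP : IsConsensusMatrix G P) (i j : Fin N) : 0 ≤ P i j :=
  (mem_doublyStochastic_iff_sum.1 hP.doublyStochastic).1 i j

lemma IsConsensusMatrix.row_sum (hP : IsConsensusMatrix G P) (i : Fin N) : ∑ j, P i j = 1 :=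
  (mem_doublyStochastic_iff_sum.1 hP.doublyStochastic).2.1 i

lemma IsConsensusMatrix.col_sum (hP : IsConsensusMatrix G P) (j : Fin N) : ∑ i, P i j = 1 :=
  (mem_doublyStochastic_iff_sum.1 hP.doublyStochastic).2.2 j

lemma IsConsensusMatrix.sum_neighbors (hP : IsConsensusMatrix G P) (i : Fin N) (x : Fin N → E) :
    ∑ j ∈ neighbors G i, P i j • x j = ∑ j, P i j • x j := by
  refine Finset.sum_subset (Finset.subset_univ _) fun j _ hj => ?_
  rw [← hP.pos_iff, not_lt] at hj
  rw [le_antisymm hj (hP.nonneg i j), zero_smul]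

lemma IsConsensusMatrix.sum_sum_smul (hP : IsConsensusMatrix G P) (x : Fin N → E) :
    ∑ i, ∑ j, P i j • x j = ∑ j, x j := by
  rw [Finset.sum_comm]
  refine Finset.sum_congr rfl fun j _ => ?_
  rw [← Finset.sum_smul, hP.col_sum, one_smul]

lemma IsConsensusMatrix.diag_pos (hP : IsConsensusMatrix G P) (i : Fin N) : 0 < P i i := by
  rw [hP.pos_iff]; simp [neighbors]

lemma finite_positive_entries (P : Matrix (Fin N) (Fin N) ℝ) :
    {x | 0 < x ∧ ∃ i j, P i j = x}.Finite := by
  refine (Set.finite_range fun z : Fin N × Fin N => P z.1 z.2).subset ?_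
  rintro x ⟨-, i, j, rfl⟩
  exact ⟨(i, j), rfl⟩

lemma minWeight_le {i j : Fin N} (h : 0 < P i j) : minWeight P ≤ P i j :=
  csInf_le (finite_positive_entries P).bddBelow ⟨h, i, j, rfl⟩

lemma IsConsensusMatrix.minWeight_pos (hP : IsConsensusMatrix G P) (hN : 0 < N) :
    0 < minWeight P :=
  have hne : {x | 0 < x ∧ ∃ i j, P i j = x}.Nonempty :=
    ⟨P ⟨0, hN⟩ ⟨0, hN⟩, hP.diag_pos _, _, _, rfl⟩
  (hne.csInf_mem (finite_positive_entries P)).1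

/-- Connectivity with at least two workers gives some row two positive entries, a self-loop and an
incoming edge; the row sums to 1. -/
lemma IsConsensusMatrix.minWeight_le_half (hP : IsConsensusMatrix G P) (hN : 2 ≤ N)
    (hG : StronglyConnected G) : minWeight P ≤ 1 / 2 := by
  classical
  obtain ⟨i, j, hij, hadj⟩ : ∃ i j : Fin N, i ≠ j ∧ G.Adj i j := by
    by_contra! hcon
    have h : ∀ i j : Fin N, Relation.ReflTransGen G.Adj i j → i = j := by
      intro i j h
      induction h with
      | refl => rfl
      | tail _ h ih =>
        rename_i b c _
        by_contra hne
        exact hcon b c (fun hbc => hne (ih.trans hbc)) h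
    have := h ⟨0, by omega⟩ ⟨1, by omega⟩ (hG _ _)
    simp at this
  have h1 : 0 < P j i := by rw [hP.pos_iff]; simp [neighbors, hadj]
  have h2 := minWeight_le h1
  have h3 := minWeight_le (hP.diag_pos j)
  have h4 : P j i + P j j ≤ 1 := by
    rw [← hP.row_sum j, ← Finset.sum_pair hij]
    exact Finset.sum_le_sum_of_subset_of_nonneg (Finset.subset_univ _)
      fun l _ _ => hP.nonneg j l
  linarith

/-- Summing the Jensen defects over all rows, row `j` alone sees the pair `j`, `l` with weight `P j
j * P j l`, at least the square of the minimal weight. Positive self-loops are essential here. -/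
lemma IsConsensusMatrix.energy_le (hP : IsConsensusMatrix G P) (hN : 0 < N) (x : Fin N → E)
    {j l : Fin N} (hjl : 0 < P j l) :
    minWeight P ^ 2 * ‖x j - x l‖ ^ 2 ≤ ∑ i, ‖x i‖ ^ 2 - ∑ i, ‖∑ j, P i j • x j‖ ^ 2 := by
  classical
  have hp := hP.minWeight_pos hN
  -- The diagonal case says that mixing does not increase energy; `contraction` uses it for the sign
  -- of the energy loss.
  rcases eq_or_ne j l with rfl | hne
  · have : ∑ i, ‖∑ j, P i j • x j‖ ^ 2 ≤ ∑ i, ‖x i‖ ^ 2 := by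
      have : ∑ i, ∑ j, P i j • ‖x j‖ ^ 2 = ∑ j, ‖x j‖ ^ 2 := hP.sum_sum_smul fun j => ‖x j‖ ^ 2
      rw [← this]
      refine Finset.sum_le_sum fun i _ => ?_
      rw [norm_sum_smul_sq (hP.row_sum i)]
      have : 0 ≤ ∑ j, ∑ l, P i j * P i l * ‖x j - x l‖ ^ 2 :=
        Finset.sum_nonneg fun j _ => Finset.sum_nonneg fun l _ =>
          mul_nonneg (mul_nonneg (hP.nonneg _ _) (hP.nonneg _ _)) (sq_nonneg _)
      simp only [smul_eq_mul]
      linarith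
    simpa using this
  have h0 : ∀ i j l, 0 ≤ P i j * P i l * ‖x j - x l‖ ^ 2 := fun i j l =>
    mul_nonneg (mul_nonneg (hP.nonneg _ _) (hP.nonneg _ _)) (sq_nonneg _)
  have hs : ∑ i, ‖∑ j, P i j • x j‖ ^ 2 = ∑ i, ‖x i‖ ^ 2
      - 1 / 2 * ∑ i, ∑ j, ∑ l, P i j * P i l * ‖x j - x l‖ ^ 2 := by
    have : ∑ i, ∑ j, P i j • ‖x j‖ ^ 2 = ∑ j, ‖x j‖ ^ 2 := hP.sum_sum_smul fun j => ‖x j‖ ^ 2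
    rw [← this, Finset.mul_sum, ← Finset.sum_sub_distrib]
    exact Finset.sum_congr rfl fun i _ => norm_sum_smul_sq (hP.row_sum i) x
  -- Both orderings of the pair are kept, which cancels the factor 1/2.
  have hlow : P j j * P j l * ‖x j - x l‖ ^ 2 + P j l * P j j * ‖x l - x j‖ ^ 2
      ≤ ∑ i, ∑ j, ∑ l, P i j * P i l * ‖x j - x l‖ ^ 2 := by
    have e1 : ∑ a, ∑ b, P j a * P j b * ‖x a - x b‖ ^ 2
        ≤ ∑ i, ∑ a, ∑ b, P i a * P i b * ‖x a - x b‖ ^ 2 :=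
      Finset.single_le_sum (f := fun i => ∑ a, ∑ b, P i a * P i b * ‖x a - x b‖ ^ 2)
        (fun i _ => Finset.sum_nonneg fun a _ => Finset.sum_nonneg fun b _ => h0 i a b)
        (Finset.mem_univ j)
    have e2 : ∑ a ∈ ({j, l} : Finset (Fin N)), ∑ b, P j a * P j b * ‖x a - x b‖ ^ 2
        ≤ ∑ a, ∑ b, P j a * P j b * ‖x a - x b‖ ^ 2 :=
      Finset.sum_le_sum_of_subset_of_nonneg (Finset.subset_univ _)
        fun a _ _ => Finset.sum_nonneg fun b _ => h0 j a b
    rw [Finset.sum_pair hne] at e2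
    have e3 := Finset.single_le_sum (f := fun b => P j j * P j b * ‖x j - x b‖ ^ 2)
      (fun b _ => h0 j j b) (Finset.mem_univ l)
    have e4 := Finset.single_le_sum (f := fun b => P j l * P j b * ‖x l - x b‖ ^ 2)
      (fun b _ => h0 j l b) (Finset.mem_univ j)
    linarith
  rw [norm_sub_rev (x l)] at hlow
  have hpp : minWeight P ^ 2 ≤ P j j * P j l := by
    rw [sq]
    exact mul_le_mul (minWeight_le (hP.diag_pos j)) (minWeight_le hjl) hp.le (hP.nonneg _ _)
  have := mul_le_mul_of_nonneg_right hpp (sq_nonneg ‖x j - x l‖)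
  rw [hs]
  nlinarith

/-- Spectral gap of a consensus matrix on families with mean zero. -/
lemma IsConsensusMatrix.contraction (hP : IsConsensusMatrix G P) (hG : StronglyConnected G)
    (hN : 0 < N) (x : Fin N → E) (hx : ∑ i, x i = 0) :
    ∑ i, ‖∑ j, P i j • x j‖ ^ 2 ≤ (1 - 2 * minWeight P ^ 2 / (N : ℝ) ^ 3) * ∑ i, ‖x i‖ ^ 2 := by
  have hp := hP.minWeight_pos hN
  have hN' : (0 : ℝ) < N := by positivity
  -- The energy loss `e` bounds each edge difference by `√e / minWeight P`, hence every pairwise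
  -- difference by `N` times that.
  set e := ∑ i, ‖x i‖ ^ 2 - ∑ i, ‖∑ j, P i j • x j‖ ^ 2 with he
  have he0 : 0 ≤ e := by
    have := hP.energy_le hN x (hP.diag_pos ⟨0, hN⟩)
    rwa [sub_self, norm_zero, zero_pow two_ne_zero, mul_zero] at this
  have hedge : ∀ i j, G.Adj i j → ‖x i - x j‖ ≤ √e / minWeight P := by
    intro i j h
    have h1 : 0 < P j i := by rw [hP.pos_iff]; simp [neighbors, h]
    have h2 := hP.energy_le hN x h1
    rw [le_div_iff₀ hp]
    refine Real.le_sqrt_of_sq_le ?_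
    rw [mul_pow, norm_sub_rev, mul_comm]
    exact h2
  have hall := norm_sub_le_of_stronglyConnected hG x (by positivity) hedge
  have hsq : ∀ i j, ‖x i - x j‖ ^ 2 ≤ (N : ℝ) ^ 2 * e / minWeight P ^ 2 := fun i j => by
    have := pow_le_pow_left₀ (norm_nonneg _) (hall i j) 2
    rwa [mul_pow, div_pow, Real.sq_sqrt he0, ← mul_div_assoc] at this
  -- Mean zero removes the cross terms, so pairwise differences recover the full energy.
  have hsum : ∑ i, ∑ j, ‖x i - x j‖ ^ 2 = 2 * N * ∑ i, ‖x i‖ ^ 2 := by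
    have : ∀ i, ∑ j, ‖x i - x j‖ ^ 2 = N * ‖x i‖ ^ 2 + ∑ j, ‖x j‖ ^ 2 := fun i => by
      simp only [norm_sub_sq_real, Finset.sum_add_distrib, Finset.sum_sub_distrib,
        ← Finset.mul_sum, ← inner_sum, hx]
      simp
    simp only [this, Finset.sum_add_distrib, ← Finset.mul_sum]
    simp
    ring
  have hle : ∑ i, ∑ j, ‖x i - x j‖ ^ 2 ≤ (N : ℝ) * (N * ((N : ℝ) ^ 2 * e / minWeight P ^ 2)) := by
    calc _ ≤ ∑ _i : Fin N, ∑ _j : Fin N, (N : ℝ) ^ 2 * e / minWeight P ^ 2 :=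
          Finset.sum_le_sum fun i _ => Finset.sum_le_sum fun j _ => hsq i j
      _ = _ := by simp
  rw [hsum] at hle
  have hfin : 2 * minWeight P ^ 2 / (N : ℝ) ^ 3 * ∑ i, ‖x i‖ ^ 2 ≤ e := by
    have h1 : (N : ℝ) * (N * ((N : ℝ) ^ 2 * e / minWeight P ^ 2))
        = (N : ℝ) ^ 4 / minWeight P ^ 2 * e := by ring
    rw [h1] at hle
    calc _ = minWeight P ^ 2 / (N : ℝ) ^ 4 * (2 * N * ∑ i, ‖x i‖ ^ 2) := by field_simp
      _ ≤ minWeight P ^ 2 / (N : ℝ) ^ 4 * ((N : ℝ) ^ 4 / minWeight P ^ 2 * e) := by gcongr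
      _ = e := by field_simp
  linarith

lemma cube_le_four_mul_two_pow (n : ℕ) : n ^ 3 ≤ 4 * 2 ^ n := by
  rcases lt_or_ge n 4 with h | h
  · interval_cases n <;> norm_num
  induction n, h using Nat.le_induction with
  | base => norm_num
  | succ n hn ih =>
    rw [pow_succ 2]
    nlinarith [Nat.mul_le_mul hn hn, Nat.mul_le_mul hn (Nat.mul_le_mul hn hn)]

/-- A lower bound for the spectral gap in terms of the smallest weight. -/
def gap (P : Matrix (Fin N) (Fin N) ℝ) : ℝ := minWeight P ^ N / 8

lemma IsConsensusMatrix.gap_pos (hP : IsConsensusMatrix G P) (hN : 0 < N) : 0 < gap P := by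
  have := hP.minWeight_pos hN
  unfold gap; positivity

lemma IsConsensusMatrix.minWeight_pow_le (hP : IsConsensusMatrix G P) (hG : StronglyConnected G)
    (hN : 2 ≤ N) : minWeight P ^ N ≤ 1 / 4 := by
  have h0 := hP.minWeight_pos (by omega)
  have h1 := hP.minWeight_le_half hN hG
  calc minWeight P ^ N ≤ minWeight P ^ 2 := pow_le_pow_of_le_one h0.le (by linarith) hN
    _ ≤ (1 / 2) ^ 2 := by gcongr
    _ = _ := by norm_num

lemma IsConsensusMatrix.gap_le (hP : IsConsensusMatrix G P) (hG : StronglyConnected G)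
    (hN : 2 ≤ N) : gap P ≤ 1 / 32 := by
  have := hP.minWeight_pow_le hG hN
  unfold gap; linarith

/-- With p ≤ 1/2 and N³ ≤ 4·2^N, the polynomial loss N³ is absorbed by p^(N-2). The result is a gap
in terms of p^N, the quantity in which C and q are expressed. -/
lemma IsConsensusMatrix.gap_le_two_mul (hP : IsConsensusMatrix G P) (hG : StronglyConnected G)
    (hN : 2 ≤ N) : gap P ≤ 2 * minWeight P ^ 2 / (N : ℝ) ^ 3 := by
  have h0 := hP.minWeight_pos (by omega)
  have h1 := hP.minWeight_le_half hN hG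
  have hN' : (0 : ℝ) < N := by positivity
  obtain ⟨n, rfl⟩ : ∃ n, N = n + 2 := ⟨N - 2, by omega⟩
  have hc : ((n + 2 : ℕ) : ℝ) ^ 3 ≤ 4 * 2 ^ (n + 2) := by
    exact_mod_cast cube_le_four_mul_two_pow (n + 2)
  rw [gap, le_div_iff₀ (by positivity), pow_add]
  have h2 : minWeight P ^ n ≤ (1 / 2) ^ n := by gcongr
  calc minWeight P ^ n * minWeight P ^ 2 / 8 * ((n + 2 : ℕ) : ℝ) ^ 3
      ≤ (1 / 2) ^ n * minWeight P ^ 2 / 8 * (4 * 2 ^ (n + 2)) := by gcongr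
    _ = 2 * minWeight P ^ 2 * ((1 / 2) ^ n * 2 ^ n) := by ring
    _ = _ := by rw [← mul_pow]; norm_num

lemma avg_consensus (hP : IsConsensusMatrix G P) (x : Fin N → E) :
    avg (fun i => ∑ j ∈ neighbors G i, P i j • x j) = avg x := by
  simp only [avg, hP.sum_neighbors, hP.sum_sum_smul]

lemma avg_sub_smul (x g : Fin N → E) (β : ℝ) :
    avg (fun i => x i - β • g i) = avg x - β • avg g := by
  simp only [avg, Finset.sum_sub_distrib, ← Finset.smul_sum, smul_sub]
  rw [smul_comm]

/-- One gradient and consensus step contracts the dispersion, up to the dispersion of the steps. -/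
lemma IsConsensusMatrix.dispersion_step_le (hP : IsConsensusMatrix G P) (hG : StronglyConnected G)
    (hN : 2 ≤ N) (x g : Fin N → E) (v : E) (β : ℝ) :
    dispersion (fun i => ∑ j ∈ neighbors G i, P i j • (x j - β • g j))
      ≤ (1 - gap P / 2) * dispersion x
        + 2 / gap P * β ^ 2 * ((1 / (N : ℝ)) * ∑ j, ‖g j - v‖ ^ 2) := by
  have hd := hP.gap_pos (by omega)
  have hd1 := hP.gap_le hG hN
  have hN' : (0 : ℝ) < N := by positivity
  -- The centred family before mixing: the deviations after the step are `P` applied to `y`, so the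
  -- contraction applies.
  set y : Fin N → E := fun j => (x j - avg x) - β • (g j - avg g) with hy
  have hysum : ∑ j, y j = 0 := by
    simp only [hy, Finset.sum_sub_distrib (s := Finset.univ) (fun j => x j - avg x),
      ← Finset.smul_sum, sum_sub_avg]
    simp
  have hdev : ∀ i, (∑ j ∈ neighbors G i, P i j • (x j - β • g j))
      - avg (fun i => ∑ j ∈ neighbors G i, P i j • (x j - β • g j)) = ∑ j, P i j • y j := by
    intro i
    rw [avg_consensus hP, avg_sub_smul, hP.sum_neighbors]
    have : ∀ j, y j = (x j - β • g j) - (avg x - β • avg g) := fun j => by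
      simp only [hy, smul_sub]; abel
    simp only [this, smul_sub _ (_ - _) (_ - _), Finset.sum_sub_distrib, ← Finset.sum_smul,
      hP.row_sum, one_smul]
  have h1 : ∑ i, ‖∑ j, P i j • y j‖ ^ 2 ≤ (1 - gap P) * ∑ i, ‖y i‖ ^ 2 := by
    refine (hP.contraction hG (by omega) y hysum).trans ?_
    have := hP.gap_le_two_mul hG hN
    gcongr
  -- Young's inequality with parameter `gap P / 2` spends half of the gap and keeps the other half
  -- as contraction.
  have h2 : ∑ i, ‖y i‖ ^ 2 ≤ (1 + gap P / 2) * ∑ i, ‖x i - avg x‖ ^ 2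
      + (1 + 1 / (gap P / 2)) * (β ^ 2 * ∑ i, ‖g i - v‖ ^ 2) := by
    calc ∑ i, ‖y i‖ ^ 2 ≤ ∑ i, ((1 + gap P / 2) * ‖x i - avg x‖ ^ 2
          + (1 + 1 / (gap P / 2)) * ‖β • (g i - avg g)‖ ^ 2) :=
          Finset.sum_le_sum fun i _ => norm_sub_sq_le_young (by positivity) _ _
      _ = (1 + gap P / 2) * ∑ i, ‖x i - avg x‖ ^ 2
          + (1 + 1 / (gap P / 2)) * (β ^ 2 * ∑ i, ‖g i - avg g‖ ^ 2) := by
          simp only [Finset.sum_add_distrib, ← Finset.mul_sum, norm_smul, mul_pow,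
            Real.norm_eq_abs, sq_abs]
      _ ≤ _ := by
          have := sum_norm_sub_avg_sq_le g v
          gcongr
  simp only [dispersion, hdev]
  have h3 : (1 - gap P) * ∑ i, ‖y i‖ ^ 2 ≤ (1 - gap P / 2) * ∑ i, ‖x i - avg x‖ ^ 2
      + 2 / gap P * (β ^ 2 * ∑ i, ‖g i - v‖ ^ 2) := by
    have hA : 0 ≤ ∑ i, ‖x i - avg x‖ ^ 2 := by positivity
    have hB : 0 ≤ β ^ 2 * ∑ i, ‖g i - v‖ ^ 2 := by positivity
    have c1 : (1 - gap P) * (1 + gap P / 2) ≤ 1 - gap P / 2 := by nlinarith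
    have c2 : (1 - gap P) * (1 + 1 / (gap P / 2)) ≤ 2 / gap P := by
      have : (1 - gap P) * (1 + 1 / (gap P / 2)) = 2 / gap P - 1 - gap P := by field_simp; ring
      linarith
    calc _ ≤ (1 - gap P) * ((1 + gap P / 2) * ∑ i, ‖x i - avg x‖ ^ 2
          + (1 + 1 / (gap P / 2)) * (β ^ 2 * ∑ i, ‖g i - v‖ ^ 2)) :=
          mul_le_mul_of_nonneg_left h2 (by linarith)
      _ = (1 - gap P) * (1 + gap P / 2) * ∑ i, ‖x i - avg x‖ ^ 2
          + (1 - gap P) * (1 + 1 / (gap P / 2)) * (β ^ 2 * ∑ i, ‖g i - v‖ ^ 2) := by ring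
      _ ≤ _ := by gcongr
  calc _ ≤ 1 / (N : ℝ) * ((1 - gap P / 2) * ∑ i, ‖x i - avg x‖ ^ 2
      + 2 / gap P * (β ^ 2 * ∑ i, ‖g i - v‖ ^ 2)) := by gcongr; exact h1.trans h3
    _ = _ := by ring

/-- The constants `C` and `q` of the consensus matrix bound the spectral gap. -/
lemma IsConsensusMatrix.le_constC_div (hP : IsConsensusMatrix G P) (hG : StronglyConnected G)
    (hN : 2 ≤ N) : constQ P < 1 ∧ 0 < constC P ∧
      1 / gap P ^ 2 ≤ 32 * (constC P / (1 - constQ P)) := by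
  have h0 : 0 < minWeight P ^ N := pow_pos (hP.minWeight_pos (by omega)) _
  have h1 := hP.minWeight_pow_le hG hN
  have hN' : (0 : ℝ) < N := by positivity
  unfold gap constQ constC
  set r := minWeight P ^ N
  have hq1 : (1 - r) ^ (1 / (N : ℝ)) < 1 :=
    Real.rpow_lt_one (by linarith) (by linarith) (by positivity)
  -- Thus 1 - q ≤ r, and with C ≥ 2/r below, C/(1-q) ≥ 2/r². As the gap is r/8, its inverse square
  -- is 64/r², whence the factor 32.
  have hq2 : 1 - r ≤ (1 - r) ^ (1 / (N : ℝ)) := by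
    conv_lhs => rw [← Real.rpow_one (1 - r)]
    refine Real.rpow_le_rpow_of_exponent_ge (by linarith) (by linarith) ?_
    rw [div_le_one hN']
    exact_mod_cast (by omega : 1 ≤ N)
  have hC : 2 * r⁻¹ ≤ 2 * (1 + r⁻¹) / (1 - r) := by
    rw [le_div_iff₀ (by linarith)]
    have : 0 < r⁻¹ := by positivity
    nlinarith
  refine ⟨hq1, lt_of_lt_of_le (by positivity) hC, ?_⟩
  calc 1 / (r / 8) ^ 2 = 32 * (2 * r⁻¹ / r) := by field_simp; norm_num
    _ ≤ _ := by
      have : 0 < 2 * r⁻¹ := by positivity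
      gcongr
      · linarith
      · linarith

end Consensus

/-! ### Gradients of the global loss -/

section Loss

variable {N a b : ℕ} {X Z W Y : Type*} {Q : Problem N a b X Z W Y}

lemma Problem.PartiallyDifferentiable.localLoss_rep (hQ : Q.PartiallyDifferentiable) (i : Fin N)
    (θ : Vec b) : Differentiable ℝ fun φ => Q.localLoss i φ θ := by
  unfold Problem.localLoss
  exact (Differentiable.fun_sum fun m _ => hQ.1 i m θ).const_mul _

lemma Problem.PartiallyDifferentiable.localLoss_head (hQ : Q.PartiallyDifferentiable) (i : Fin N)
    (φ : Vec a) : Differentiable ℝ fun θ => Q.localLoss i φ θ := by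
  unfold Problem.localLoss
  exact (Differentiable.fun_sum fun m _ => hQ.2 i m φ).const_mul _

lemma Problem.PartiallyDifferentiable.globalLoss_rep (hQ : Q.PartiallyDifferentiable)
    (θ : Fin N → Vec b) : Differentiable ℝ fun φ => Q.globalLoss φ θ := by
  unfold Problem.globalLoss
  exact (Differentiable.fun_sum fun i _ => hQ.localLoss_rep i (θ i)).const_mul _

lemma Problem.PartiallyDifferentiable.gradient_globalLoss (hQ : Q.PartiallyDifferentiable)
    (φ : Vec a) (θ : Fin N → Vec b) :
    gradient (fun φ' => Q.globalLoss φ' θ) φ = Q.globalGradRep φ θ := by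
  refine HasGradientAt.gradient ?_
  rw [hasGradientAt_iff_hasFDerivAt]
  have h : HasFDerivAt (fun φ' => ∑ i, Q.localLoss i φ' (θ i))
      (∑ i, InnerProductSpace.toDual ℝ (Vec a) (Q.gradRep i φ (θ i))) φ :=
    HasFDerivAt.fun_sum fun i _ => (hQ.localLoss_rep i (θ i) φ).hasGradientAt.hasFDerivAt
  have h' := h.const_mul (1 / (N : ℝ))
  refine h'.congr_fderiv ?_
  simp [Problem.globalGradRep, map_sum]

lemma Problem.globalGradRep_eq_avg (φ : Vec a) (θ : Fin N → Vec b) :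
    Q.globalGradRep φ θ = avg fun i => Q.gradRep i φ (θ i) := rfl

lemma avg_sub {E : Type*} [NormedAddCommGroup E] [InnerProductSpace ℝ E] (x y : Fin N → E) :
    avg x - avg y = avg fun i => x i - y i := by
  simp only [avg, Finset.sum_sub_distrib, smul_sub]

lemma Problem.LipschitzGradients.norm_globalGradRep_sub_avg_sq_le {L : ℝ}
    (hL : Q.LipschitzGradients L) (φ : Fin N → Vec a) (θ : Fin N → Vec b) :
    ‖Q.globalGradRep (avg φ) θ - avg (fun i => Q.gradRep i (φ i) (θ i))‖ ^ 2
      ≤ L ^ 2 * dispersion φ := by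
  rw [Q.globalGradRep_eq_avg, avg_sub]
  refine (norm_avg_sq_le _).trans ?_
  rw [dispersion, mul_left_comm, Finset.mul_sum Finset.univ _ (L ^ 2)]
  refine mul_le_mul_of_nonneg_left (Finset.sum_le_sum fun i _ => ?_) (by positivity)
  have h := hL.1 i (avg φ) (φ i) (θ i) (θ i)
  rw [sub_self, norm_zero, add_zero, norm_sub_rev (avg φ)] at h
  rw [← mul_pow]
  gcongr

lemma Problem.LipschitzGradients.globalGradRep {L : ℝ}
    (hL : Q.LipschitzGradients L) (hN : 0 < N) (φ φ' : Vec a) (θ : Fin N → Vec b) :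
    ‖Q.globalGradRep φ θ - Q.globalGradRep φ' θ‖ ≤ L * ‖φ - φ'‖ := by
  have hN' : (0 : ℝ) < N := by positivity
  rw [Q.globalGradRep_eq_avg, Q.globalGradRep_eq_avg, avg_sub, avg, norm_smul,
    Real.norm_of_nonneg (by positivity)]
  have h : ‖∑ i, (Q.gradRep i φ (θ i) - Q.gradRep i φ' (θ i))‖ ≤ N * (L * ‖φ - φ'‖) := by
    refine (norm_sum_le _ _).trans ?_
    calc _ ≤ ∑ _i : Fin N, L * ‖φ - φ'‖ := Finset.sum_le_sum fun i _ => by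
          simpa using hL.1 i φ φ' (θ i) (θ i)
      _ = _ := by simp
  calc _ ≤ 1 / (N : ℝ) * (N * (L * ‖φ - φ'‖)) := by gcongr
    _ = _ := by field_simp

end Loss

/-! ### The order in which mini-batches are drawn -/

section Past

variable {N : ℕ}

/-- The mini-batches drawn before the local head step `s` of round `k`. -/
def past (N τ k s : ℕ) : Finset (Fin N × ℕ × Option (Fin τ)) :=
  open Classical in
  (Finset.univ ×ˢ Finset.range (k + 1) ×ˢ Finset.univ).filter fun j =>
    j.2.1 < k ∨ ∃ t : Fin τ, j.2.2 = some t ∧ t.1 < s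

lemma mem_past {τ k s : ℕ} {j : Fin N × ℕ × Option (Fin τ)} :
    j ∈ past N τ k s ↔ j.2.1 < k + 1 ∧ (j.2.1 < k ∨ ∃ t : Fin τ, j.2.2 = some t ∧ t.1 < s) := by
  simp [past]

lemma past_mono {τ k s s' : ℕ} (h : s ≤ s') : past N τ k s ⊆ past N τ k s' := by
  intro j hj
  rw [mem_past] at hj ⊢
  refine ⟨hj.1, hj.2.imp_right ?_⟩
  rintro ⟨t, ht, hs⟩
  exact ⟨t, ht, hs.trans_le h⟩

lemma past_subset_succ {τ k s : ℕ} : past N τ k s ⊆ past N τ (k + 1) 0 := by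
  intro j hj
  rw [mem_past] at hj ⊢
  exact ⟨by omega, Or.inl hj.1⟩

lemma head_mem_past {τ k s : ℕ} (i : Fin N) (hs : s < τ) :
    (i, k, some ⟨s, hs⟩) ∈ past N τ k (s + 1) := by
  simp [mem_past]

lemma head_notMem_past {τ k s : ℕ} (i : Fin N) (hs : s < τ) :
    (i, k, some ⟨s, hs⟩) ∉ past N τ k s := by
  simp [mem_past]

lemma rep_mem_past {τ k : ℕ} (i : Fin N) : (i, k, none) ∈ past N τ (k + 1) 0 := by
  simp [mem_past]

/-- Valid for every `s`: `past N τ k τ` contains all head batches of round `k` but no representation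
batch, so it is the information available just before the representation step. -/
lemma rep_notMem_past {τ k s : ℕ} (i : Fin N) : (i, k, none) ∉ past N τ k s := by
  simp [mem_past]

end Past

/-! ### Local head steps -/

section Rounds

variable {N a b : ℕ} {X Z W Y Ω : Type*} {Q : Problem N a b X Z W Y} {S : Batches Q Ω} {τ : ℕ}

lemma DeterminedBy.headIterate {α : ℝ} {i : Fin N} {k : ℕ} {φ : Ω → Vec a} {θ : Ω → Vec b}
    (hφ : DeterminedBy (S.family τ) (past N τ k 0) φ)
    (hθ : DeterminedBy (S.family τ) (past N τ k 0) θ) {s : ℕ} (hs : s ≤ τ) :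
    DeterminedBy (S.family τ) (past N τ k s)
      fun ω => headIterate Q S α i k ω (φ ω) (θ ω) s := by
  induction s with
  | zero => exact hθ
  | succ s ih =>
    have h1 := (ih (by omega)).mono (past_mono (N := N) (k := k) s.le_succ)
    have h2 := hφ.mono (past_mono (N := N) (k := k) (s + 1).zero_le)
    have h3 : DeterminedBy (S.family τ) (past N τ k (s + 1)) (S.headBatch i k s) :=
      DeterminedBy.self (Y := S.family τ) (head_mem_past i (by omega : s < τ))
    intro ω ω' h
    have e1 := h1 ω ω' h
    have e2 := h2 ω ω' h
    have e3 := h3 ω ω' h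
    simp only [DePRL.headIterate] at e1 ⊢
    rw [e1, e2, e3]

variable [MeasurableSpace Ω] {μ : Measure Ω} [IsProbabilityMeasure μ]

/-- One local head step. -/
lemma integral_localLoss_headIterate_succ_le {L σ α : ℝ} (hα : 0 ≤ α) (hL0 : 0 ≤ L)
    (hQ : Q.PartiallyDifferentiable) (hL : Q.LipschitzGradients L)
    (hS : S.IsIndependentSampling μ τ) (hU : S.Unbiased μ τ) (hV : S.BoundedVariance μ τ σ)
    {i : Fin N} {k : ℕ} {φ x : Ω → Vec a} {θ : Ω → Vec b}
    (hφ : DeterminedBy (S.family τ) (past N τ k 0) φ)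
    (hx : DeterminedBy (S.family τ) (past N τ k 0) x)
    (hθ : DeterminedBy (S.family τ) (past N τ k 0) θ) {s : ℕ} (hs : s < τ) :
    ∫ ω, ‖Q.batchGradHead i (S.headBatch i k s ω) (φ ω)
        (headIterate Q S α i k ω (φ ω) (θ ω) s)‖ ^ 2 ∂μ
      ≤ ∫ ω, ‖Q.gradHead i (φ ω) (headIterate Q S α i k ω (φ ω) (θ ω) s)‖ ^ 2 ∂μ + σ ^ 2 ∧
    ∫ ω, Q.localLoss i (x ω) (headIterate Q S α i k ω (φ ω) (θ ω) (s + 1)) ∂μ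
      ≤ ∫ ω, Q.localLoss i (x ω) (headIterate Q S α i k ω (φ ω) (θ ω) s) ∂μ
        - α / 2 * ∫ ω, ‖Q.gradHead i (x ω) (headIterate Q S α i k ω (φ ω) (θ ω) s)‖ ^ 2 ∂μ
        - α / 2 * (1 - L * α) *
          ∫ ω, ‖Q.gradHead i (φ ω) (headIterate Q S α i k ω (φ ω) (θ ω) s)‖ ^ 2 ∂μ
        + (α * L ^ 2 / 2 * ∫ ω, ‖φ ω - x ω‖ ^ 2 ∂μ + L * α ^ 2 * σ ^ 2 / 2) := by
  set y : ℕ → Ω → Vec b := fun s ω => headIterate Q S α i k ω (φ ω) (θ ω) s with hy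
  have hys : DeterminedBy (S.family τ) (past N τ k s) (y s) := hφ.headIterate hθ hs.le
  have hys' : DeterminedBy (S.family τ) (past N τ k (s + 1)) (y s) := hys.mono (past_mono s.le_succ)
  have hyss : DeterminedBy (S.family τ) (past N τ k (s + 1)) (y (s + 1)) := hφ.headIterate hθ hs
  have hφs := hφ.mono (past_mono (N := N) (k := k) s.zero_le)
  have hxs := hx.mono (past_mono (N := N) (k := k) s.zero_le)
  have hφ' := hφ.mono (past_mono (N := N) (k := k) (s + 1).zero_le)
  have hx' := hx.mono (past_mono (N := N) (k := k) (s + 1).zero_le)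
  -- The state to freeze contains both `φ`, where the gradient is sampled, and `x`, where the loss
  -- is measured; `x` will be the mean representation.
  have hst : DeterminedBy (S.family τ) (past N τ k s) fun ω => (φ ω, x ω, y s ω) :=
    hφs.comp₂ (hxs.comp₂ hys Prod.mk) Prod.mk
  have hB : DeterminedBy (S.family τ) (past N τ k (s + 1)) (S.headBatch i k s) :=
    DeterminedBy.self (Y := S.family τ) (head_mem_past i hs)
  set g : Ω → Vec b := fun ω => Q.batchGradHead i (S.headBatch i k s ω) (φ ω) (y s ω) with hg
  have hgd : DeterminedBy (S.family τ) (past N τ k (s + 1)) g :=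
    hB.comp₂ (hφ'.comp₂ hys' Prod.mk) fun B z => Q.batchGradHead i B z.1 z.2
  have hsq : ∫ ω, ‖g ω‖ ^ 2 ∂μ ≤ ∫ ω, ‖Q.gradHead i (φ ω) (y s ω)‖ ^ 2 ∂μ + σ ^ 2 :=
    hst.integral_norm_sq_le hS.measurable hS.indep (head_notMem_past i hs)
      (fun z B => Q.batchGradHead i B z.1 z.2.2) (m := fun z => Q.gradHead i z.1 z.2.2)
      (fun z => hU.2 i k s hs z.1 z.2.2) (fun z => hV.2 i k s hs z.1 z.2.2)
  refine ⟨hsq, ?_⟩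
  have hin : ∫ ω, inner ℝ (Q.gradHead i (x ω) (y s ω)) (g ω) ∂μ
      = ∫ ω, inner ℝ (Q.gradHead i (x ω) (y s ω)) (Q.gradHead i (φ ω) (y s ω)) ∂μ :=
    hst.integral_inner_eq hS.measurable hS.indep (head_notMem_past i hs)
      (fun z => Q.gradHead i z.2.1 z.2.2)
      (fun z B => Q.batchGradHead i B z.1 z.2.2) (m := fun z => Q.gradHead i z.1 z.2.2)
      (fun z => hU.2 i k s hs z.1 z.2.2)
  have hu := hxs.comp₂ hys fun x y => Q.gradHead i x y
  have hw := hφs.comp₂ hys fun x y => Q.gradHead i x y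
  have iF0 := (hxs.comp₂ hys fun x y => Q.localLoss i x y).integrable (μ := μ) hS.measurable
  have iF1 := (hx'.comp₂ hyss fun x y => Q.localLoss i x y).integrable (μ := μ) hS.measurable
  have iug := ((hu.mono (past_mono s.le_succ)).comp₂ hgd fun u g => inner ℝ u g).integrable
    (μ := μ) hS.measurable
  have iuw := (hu.comp₂ hw fun u g => inner ℝ u g).integrable (μ := μ) hS.measurable
  have igg := (hgd.comp fun g => ‖g‖ ^ 2).integrable (μ := μ) hS.measurable
  have iuu := (hu.comp fun g => ‖g‖ ^ 2).integrable (μ := μ) hS.measurable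
  have iww := (hw.comp fun g => ‖g‖ ^ 2).integrable (μ := μ) hS.measurable
  have idd := (hφ.comp₂ hx fun p q => ‖p - q‖ ^ 2).integrable (μ := μ) hS.measurable
  have hdesc : ∫ ω, Q.localLoss i (x ω) (y (s + 1) ω) ∂μ
      ≤ ∫ ω, Q.localLoss i (x ω) (y s ω) ∂μ
        - α * ∫ ω, inner ℝ (Q.gradHead i (x ω) (y s ω)) (g ω) ∂μ
        + L / 2 * α ^ 2 * ∫ ω, ‖g ω‖ ^ 2 ∂μ := by
    have iFu : Integrable (fun ω => Q.localLoss i (x ω) (y s ω)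
        - α * inner ℝ (Q.gradHead i (x ω) (y s ω)) (g ω)) μ := iF0.sub (iug.const_mul _)
    rw [← integral_const_mul, ← integral_const_mul, ← integral_sub iF0 (iug.const_mul _),
      ← integral_add iFu (igg.const_mul _)]
    refine integral_mono iF1 (iFu.add (igg.const_mul _)) fun ω => ?_
    have h := le_quadratic_of_lipschitz_gradient (hQ.localLoss_head i (x ω)) (L := L)
      (fun p q => by simpa [Problem.gradHead] using hL.2 i (x ω) (x ω) p q) (y s ω) (y (s + 1) ω)
    have e : y (s + 1) ω - y s ω = -(α • g ω) := by
      simp only [hy, hg, headIterate]; abel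
    rw [e, inner_neg_right, real_inner_smul_right, norm_neg, norm_smul, mul_pow, Real.norm_eq_abs,
      sq_abs] at h
    change Q.localLoss i (x ω) (y (s + 1) ω) ≤ Q.localLoss i (x ω) (y s ω)
        - α * inner ℝ (Q.gradHead i (x ω) (y s ω)) (g ω) + L / 2 * α ^ 2 * ‖g ω‖ ^ 2
    have e' : gradient (fun θ => Q.localLoss i (x ω) θ) (y s ω) = Q.gradHead i (x ω) (y s ω) := rfl
    rw [e'] at h
    linarith
  -- Polarization of the inner product, the difference of the two gradients being controlled by `‖φ
  -- - x‖`.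
  have hpol : 1 / 2 * ∫ ω, ‖Q.gradHead i (x ω) (y s ω)‖ ^ 2 ∂μ
      + 1 / 2 * ∫ ω, ‖Q.gradHead i (φ ω) (y s ω)‖ ^ 2 ∂μ
      ≤ ∫ ω, inner ℝ (Q.gradHead i (x ω) (y s ω)) (Q.gradHead i (φ ω) (y s ω)) ∂μ
        + L ^ 2 / 2 * ∫ ω, ‖φ ω - x ω‖ ^ 2 ∂μ := by
    rw [← integral_const_mul, ← integral_const_mul, ← integral_const_mul,
      ← integral_add (iuu.const_mul _) (iww.const_mul _), ← integral_add iuw (idd.const_mul _)]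
    refine integral_mono ((iuu.const_mul _).add (iww.const_mul _)) (iuw.add (idd.const_mul _))
      fun ω => ?_
    have h := hL.2 i (x ω) (φ ω) (y s ω) (y s ω)
    rw [sub_self, norm_zero, add_zero, norm_sub_rev (x ω)] at h
    have h2 := pow_le_pow_left₀ (norm_nonneg _) h 2
    rw [norm_sub_sq_real, mul_pow] at h2
    change 1 / 2 * ‖Q.gradHead i (x ω) (y s ω)‖ ^ 2 + 1 / 2 * ‖Q.gradHead i (φ ω) (y s ω)‖ ^ 2
      ≤ inner ℝ (Q.gradHead i (x ω) (y s ω)) (Q.gradHead i (φ ω) (y s ω))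
        + L ^ 2 / 2 * ‖φ ω - x ω‖ ^ 2
    linarith
  rw [hin] at hdesc
  have h1 := mul_le_mul_of_nonneg_left hpol hα
  have h2 := mul_le_mul_of_nonneg_left hsq (by positivity : 0 ≤ L / 2 * α ^ 2)
  linarith

/-- The local head steps of one worker in one round. -/
lemma integral_localLoss_headIterate_le {L σ α : ℝ} (hα : 0 ≤ α) (hL0 : 0 ≤ L) (hτ : 1 ≤ τ)
    (hατ : L * (α * τ) ≤ 1 / 2)
    (hQ : Q.PartiallyDifferentiable) (hL : Q.LipschitzGradients L)
    (hS : S.IsIndependentSampling μ τ) (hU : S.Unbiased μ τ) (hV : S.BoundedVariance μ τ σ)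
    (i : Fin N) (k : ℕ) {φ x : Ω → Vec a} {θ : Ω → Vec b}
    (hφ : DeterminedBy (S.family τ) (past N τ k 0) φ)
    (hx : DeterminedBy (S.family τ) (past N τ k 0) x)
    (hθ : DeterminedBy (S.family τ) (past N τ k 0) θ) :
    ∫ ω, Q.localLoss i (x ω) (headIterate Q S α i k ω (φ ω) (θ ω) τ) ∂μ
      ≤ ∫ ω, Q.localLoss i (x ω) (θ ω) ∂μ
        - α * τ / 4 * ∫ ω, ‖Q.gradHead i (x ω) (θ ω)‖ ^ 2 ∂μ
        + α * τ * L ^ 2 / 2 * ∫ ω, ‖φ ω - x ω‖ ^ 2 ∂μ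
        + (L * α ^ 2 * τ / 2 + α ^ 3 * τ ^ 3 * L ^ 2 / 2) * σ ^ 2 := by
  set y : ℕ → Ω → Vec b := fun s ω => headIterate Q S α i k ω (φ ω) (θ ω) s with hy
  set U : ℕ → ℝ := fun s => ∫ ω, ‖Q.gradHead i (x ω) (y s ω)‖ ^ 2 ∂μ with hUdef
  set V : ℕ → ℝ := fun s => ∫ ω, ‖Q.gradHead i (φ ω) (y s ω)‖ ^ 2 ∂μ with hVdef
  set D := ∫ ω, ‖φ ω - x ω‖ ^ 2 ∂μ
  have hV0 : ∀ s, 0 ≤ V s := fun s => integral_nonneg fun ω => sq_nonneg _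
  have hτ' : (1 : ℝ) ≤ τ := by exact_mod_cast hτ
  have hLα : L * α ≤ 1 / 2 := by
    have : L * α ≤ L * (α * τ) := by
      gcongr; exact le_mul_of_one_le_right hα hτ'
    linarith
  have hstep := fun s (hs : s < τ) => integral_localLoss_headIterate_succ_le (i := i) (k := k)
    hα hL0 hQ hL hS hU hV hφ hx hθ hs
  have hsum : ∀ n ≤ τ, ∫ ω, Q.localLoss i (x ω) (y n ω) ∂μ
      ≤ ∫ ω, Q.localLoss i (x ω) (θ ω) ∂μ - α / 2 * ∑ s ∈ Finset.range n, U s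
        - α / 4 * ∑ s ∈ Finset.range n, V s
        + n * (α * L ^ 2 / 2 * D + L * α ^ 2 * σ ^ 2 / 2) := by
    intro n hn
    induction n with
    | zero => simp [hy, headIterate]
    | succ n ih =>
      have h1 := ih (by omega)
      have h2 := (hstep n (by omega)).2
      -- `L * α ≤ 1 / 2` retains half of the `V` term; it is saved to absorb the drift of the heads.
      have h3 : α / 4 * V n ≤ α / 2 * (1 - L * α) * V n := by
        have := hV0 n
        gcongr
        nlinarith
      rw [Finset.sum_range_succ, Finset.sum_range_succ]
      push_cast
      simp only [hUdef, hVdef, hy] at h1 h2 h3 ⊢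
      linarith
  -- M(k) contains the head gradient at the start of the round, whereas descent produces it at every
  -- local step. The discrepancy is bounded through the displacement, a sum of at most `τ`
  -- stochastic gradients.
  have hdrift : ∀ s < τ, U 0 ≤ 2 * U s
      + 2 * L ^ 2 * (α ^ 2 * τ * (∑ r ∈ Finset.range τ, V r + τ * σ ^ 2)) := by
    intro s hs
    set g : ℕ → Ω → Vec b := fun r ω => Q.batchGradHead i (S.headBatch i k r ω) (φ ω) (y r ω)
    have hgd : ∀ r < τ, DeterminedBy (S.family τ) (past N τ k τ) (g r) := by
      intro r hr
      have hB : DeterminedBy (S.family τ) (past N τ k τ) (S.headBatch i k r) :=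
        (DeterminedBy.self (Y := S.family τ) (head_mem_past i hr)).mono (past_mono hr)
      have hyr : DeterminedBy (S.family τ) (past N τ k τ) (y r) :=
        (hφ.headIterate hθ hr.le).mono (past_mono hr.le)
      exact hB.comp₂ ((hφ.mono (past_mono τ.zero_le)).comp₂ hyr Prod.mk)
        fun B z => Q.batchGradHead i B z.1 z.2
    have hyd : ∀ r ≤ τ, DeterminedBy (S.family τ) (past N τ k τ) (y r) := fun r hr =>
      (hφ.headIterate hθ hr).mono (past_mono hr)
    have hxd := hx.mono (past_mono (N := N) (k := k) τ.zero_le)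
    have iu : ∀ r ≤ τ, Integrable (fun ω => ‖Q.gradHead i (x ω) (y r ω)‖ ^ 2) μ := fun r hr =>
      (hxd.comp₂ (hyd r hr) fun x y => ‖Q.gradHead i x y‖ ^ 2).integrable hS.measurable
    have ig : ∀ r < τ, Integrable (fun ω => ‖g r ω‖ ^ 2) μ := fun r hr =>
      ((hgd r hr).comp fun y => ‖y‖ ^ 2).integrable hS.measurable
    have hyn : ∀ n ω, y n ω = θ ω - α • ∑ r ∈ Finset.range n, g r ω := by
      intro n ω
      induction n with
      | zero => simp [hy, headIterate]
      | succ n ih =>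
        rw [Finset.sum_range_succ, smul_add, ← sub_sub, ← ih]
        rfl
    have hpt : ∀ ω, ‖Q.gradHead i (x ω) (y 0 ω)‖ ^ 2 ≤ 2 * ‖Q.gradHead i (x ω) (y s ω)‖ ^ 2
        + 2 * L ^ 2 * (α ^ 2 * τ) * ∑ r ∈ Finset.range s, ‖g r ω‖ ^ 2 := by
      intro ω
      have h1 := hL.2 i (x ω) (x ω) (y 0 ω) (y s ω)
      have h2 : ‖y 0 ω - y s ω‖ ^ 2 ≤ α ^ 2 * τ * ∑ r ∈ Finset.range s, ‖g r ω‖ ^ 2 := by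
        have e : y 0 ω - y s ω = α • ∑ r ∈ Finset.range s, g r ω := by
          rw [hyn s, hyn 0]; simp
        rw [e, norm_smul, mul_pow, Real.norm_eq_abs, sq_abs, mul_assoc]
        have h3 := norm_sum_sq_le (Finset.range s) fun r => g r ω
        rw [Finset.card_range] at h3
        have h4 : (s : ℝ) ≤ τ := by exact_mod_cast hs.le
        gcongr
        refine h3.trans ?_
        gcongr
      rw [sub_self, norm_zero, zero_add] at h1
      have h3 := pow_le_pow_left₀ (norm_nonneg _) h1 2
      rw [mul_pow] at h3
      have h4 := mul_le_mul_of_nonneg_left h2 (sq_nonneg L)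
      have h5 := norm_sub_norm_le (Q.gradHead i (x ω) (y 0 ω)) (Q.gradHead i (x ω) (y s ω))
      set A := ‖Q.gradHead i (x ω) (y 0 ω)‖
      set B := ‖Q.gradHead i (x ω) (y s ω)‖
      set C := ‖Q.gradHead i (x ω) (y 0 ω) - Q.gradHead i (x ω) (y s ω)‖
      have h6 : A ^ 2 ≤ 2 * B ^ 2 + 2 * C ^ 2 := by
        have : 0 ≤ A := norm_nonneg _
        have : 0 ≤ B := norm_nonneg _
        nlinarith [sq_nonneg (B - C)]
      linarith
    have hint : U 0 ≤ 2 * U s + 2 * L ^ 2 * (α ^ 2 * τ) *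
        ∑ r ∈ Finset.range s, ∫ ω, ‖g r ω‖ ^ 2 ∂μ := by
      have igs : ∀ r ∈ Finset.range s, Integrable (fun ω => ‖g r ω‖ ^ 2) μ := fun r hr =>
        ig r ((Finset.mem_range.1 hr).trans hs)
      rw [← integral_finsetSum _ igs, ← integral_const_mul, ← integral_const_mul,
        ← integral_add ((iu s hs.le).const_mul _) ((integrable_finsetSum _ igs).const_mul _)]
      exact integral_mono (iu 0 τ.zero_le)
        (((iu s hs.le).const_mul _).add ((integrable_finsetSum _ igs).const_mul _)) hpt
    refine hint.trans ?_
    have hbound : ∑ r ∈ Finset.range s, ∫ ω, ‖g r ω‖ ^ 2 ∂μ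
        ≤ ∑ r ∈ Finset.range τ, V r + τ * σ ^ 2 := by
      calc _ ≤ ∑ r ∈ Finset.range τ, ∫ ω, ‖g r ω‖ ^ 2 ∂μ :=
            Finset.sum_le_sum_of_subset_of_nonneg (Finset.range_mono hs.le)
              fun r _ _ => integral_nonneg fun ω => sq_nonneg _
        _ ≤ ∑ r ∈ Finset.range τ, (V r + σ ^ 2) :=
            Finset.sum_le_sum fun r hr => (hstep r (Finset.mem_range.1 hr)).1
        _ = _ := by simp [Finset.sum_add_distrib]
    have : 0 ≤ 2 * L ^ 2 * (α ^ 2 * τ) := by positivity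
    have := mul_le_mul_of_nonneg_left hbound this
    linarith
  have hτU : τ * U 0 ≤ 2 * ∑ s ∈ Finset.range τ, U s
      + τ * (2 * L ^ 2 * (α ^ 2 * τ * (∑ r ∈ Finset.range τ, V r + τ * σ ^ 2))) := by
    calc τ * U 0 = ∑ _s ∈ Finset.range τ, U 0 := by simp
      _ ≤ ∑ s ∈ Finset.range τ, (2 * U s
          + 2 * L ^ 2 * (α ^ 2 * τ * (∑ r ∈ Finset.range τ, V r + τ * σ ^ 2))) :=
          Finset.sum_le_sum fun s hs => hdrift s (Finset.mem_range.1 hs)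
      _ = _ := by rw [Finset.sum_add_distrib, ← Finset.mul_sum]; simp
  have hfin := hsum τ le_rfl
  set SU := ∑ s ∈ Finset.range τ, U s
  set SV := ∑ s ∈ Finset.range τ, V s
  have hSV : 0 ≤ SV := Finset.sum_nonneg fun s _ => hV0 s
  -- The drift contributes `α / 2 * (L * (α * τ)) ^ 2 * SV`, at most `α / 8 * SV`, which the saved
  -- `α / 4 * SV` covers.
  have hsmall : (L * (α * τ)) ^ 2 ≤ 1 / 4 := by
    have : 0 ≤ L * (α * τ) := by positivity
    nlinarith
  have hU0 : U 0 = ∫ ω, ‖Q.gradHead i (x ω) (θ ω)‖ ^ 2 ∂μ := rfl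
  rw [← hU0]
  have h1 := mul_le_mul_of_nonneg_left hτU (by positivity : 0 ≤ α / 4)
  have h2 := mul_le_mul_of_nonneg_left hsmall (mul_nonneg (by positivity : 0 ≤ α / 2) hSV)
  have h3 := mul_nonneg hα hSV
  change ∫ ω, Q.localLoss i (x ω) (y τ ω) ∂μ ≤ _
  linarith

end Rounds

/-! ### The averaged representation step and its noise -/

section RepStep

variable {N a b : ℕ} {X Z W Y Ω : Type*} {Q : Problem N a b X Z W Y} {S : Batches Q Ω} {τ : ℕ}
  [MeasurableSpace Ω] {μ : Measure Ω} [IsProbabilityMeasure μ]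

/-- The noise of the averaged stochastic gradients is orthogonal to the past, and its variance
decreases with the number of workers. -/
lemma integral_avg_noise {σ : ℝ} (hN : 0 < N)
    (hS : S.IsIndependentSampling μ τ) (hU : S.Unbiased μ τ) (hV : S.BoundedVariance μ τ σ)
    {k : ℕ} {φ : Ω → Fin N → Vec a} {θ : Ω → Fin N → Vec b}
    (hφ : DeterminedBy (S.family τ) (past N τ k τ) φ)
    (hθ : DeterminedBy (S.family τ) (past N τ k τ) θ) :
    (∀ u : Ω → Vec a, DeterminedBy (S.family τ) (past N τ k τ) u →
      ∫ ω, inner ℝ (u ω) (avg fun i => Q.batchGradRep i (S.repBatch i k ω) (φ ω i) (θ ω i)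
        - Q.gradRep i (φ ω i) (θ ω i)) ∂μ = 0) ∧
    ∫ ω, ‖avg fun i => Q.batchGradRep i (S.repBatch i k ω) (φ ω i) (θ ω i)
        - Q.gradRep i (φ ω i) (θ ω i)‖ ^ 2 ∂μ ≤ σ ^ 2 / N := by
  classical
  have hN' : (0 : ℝ) < N := by positivity
  set ξ : Fin N → Ω → Vec a := fun i ω =>
    Q.batchGradRep i (S.repBatch i k ω) (φ ω i) (θ ω i) - Q.gradRep i (φ ω i) (θ ω i) with hξ
  have hmean : ∀ (i : Fin N) (p : Vec a) (q : Vec b),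
      ∫ ω, (Q.batchGradRep i (S.repBatch i k ω) p q - Q.gradRep i p q) ∂μ = 0 := by
    intro i p q
    have hi : Integrable (fun ω => Q.batchGradRep i (S.repBatch i k ω) p q) μ :=
      ((DeterminedBy.self (Y := S.family τ) (rep_mem_past (N := N) (τ := τ) (k := k) i)).comp
        fun B => Q.batchGradRep i B p q).integrable hS.measurable
    rw [integral_sub hi (integrable_const _), hU.1 i k p q]
    simp
  have hξd : ∀ (i : Fin N) (T : Finset (Fin N × ℕ × Option (Fin τ))), past N τ k τ ⊆ T →
      (i, k, none) ∈ T → DeterminedBy (S.family τ) T (ξ i) := by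
    intro i T hT hi
    have hB : DeterminedBy (S.family τ) T (S.repBatch i k) :=
      DeterminedBy.self (Y := S.family τ) hi
    exact hB.comp₂ ((hφ.mono hT).comp₂ (hθ.mono hT) Prod.mk) fun B z =>
      Q.batchGradRep i B (z.1 i) (z.2 i) - Q.gradRep i (z.1 i) (z.2 i)
  have horth : ∀ (i : Fin N) (T : Finset (Fin N × ℕ × Option (Fin τ))) (u : Ω → Vec a),
      past N τ k τ ⊆ T → (i, k, none) ∉ T → DeterminedBy (S.family τ) T u →
      ∫ ω, inner ℝ (u ω) (ξ i ω) ∂μ = 0 := by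
    intro i T u hT hi hu
    have hst := hu.comp₂ ((hφ.mono hT).comp₂ (hθ.mono hT) Prod.mk) Prod.mk
    have := hst.integral_inner_eq (μ := μ) hS.measurable hS.indep hi (fun z => z.1)
      (fun z B => Q.batchGradRep i B (z.2.1 i) (z.2.2 i) - Q.gradRep i (z.2.1 i) (z.2.2 i))
      (m := fun _ => 0) (fun z => hmean i (z.2.1 i) (z.2.2 i))
    exact this.trans (by simp)
  have hξ' : ∀ i, DeterminedBy (S.family τ) (past N τ (k + 1) 0) (ξ i) := fun i =>
    hξd i _ past_subset_succ (rep_mem_past i)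
  constructor
  · intro u hu
    have hu' := hu.mono (past_subset_succ (N := N) (τ := τ) (k := k) (s := τ))
    simp only [avg, real_inner_smul_right, inner_sum]
    rw [integral_const_mul, integral_finsetSum _ fun i _ =>
      ((hu'.comp₂ (hξ' i) fun u v => inner ℝ u v).integrable hS.measurable)]
    simp only [horth _ _ u subset_rfl (rep_notMem_past _) hu]
    simp
  · have hexp : ∀ ω, ‖avg fun i => ξ i ω‖ ^ 2
        = (1 / (N : ℝ)) ^ 2 * ∑ i, ∑ j, inner ℝ (ξ i ω) (ξ j ω) := fun ω => by
      rw [avg, norm_smul, mul_pow, Real.norm_eq_abs, sq_abs, ← real_inner_self_eq_norm_sq,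
        sum_inner]
      simp only [inner_sum]
    have hii : ∀ i j, Integrable (fun ω => inner ℝ (ξ i ω) (ξ j ω)) μ := fun i j =>
      ((hξ' i).comp₂ (hξ' j) fun u v => inner ℝ u v).integrable hS.measurable
    -- Adjoin worker `i`'s batch to the past: `ξ i` becomes determined while the batch of `j` is
    -- still fresh. Only the `N` diagonal terms survive, divided by `N ^ 2`.
    have hzero : ∀ i j, i ≠ j → ∫ ω, inner ℝ (ξ i ω) (ξ j ω) ∂μ = 0 := by
      intro i j hij
      refine horth j (insert (i, k, none) (past N τ k τ)) (ξ i) (Finset.subset_insert _ _) ?_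
        (hξd i _ (Finset.subset_insert _ _) (Finset.mem_insert_self _ _))
      rw [Finset.mem_insert, not_or]
      refine ⟨fun h => hij ?_, rep_notMem_past j⟩
      exact (congrArg Prod.fst h).symm
    have hdiag : ∀ i, ∫ ω, inner ℝ (ξ i ω) (ξ i ω) ∂μ ≤ σ ^ 2 := by
      intro i
      simp only [real_inner_self_eq_norm_sq]
      exact (hφ.comp₂ hθ Prod.mk).integral_le hS.measurable hS.indep (rep_notMem_past i)
        (fun z B => ‖Q.batchGradRep i B (z.1 i) (z.2 i) - Q.gradRep i (z.1 i) (z.2 i)‖ ^ 2)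
        fun z => hV.1 i k (z.1 i) (z.2 i)
    change ∫ ω, ‖avg fun i => ξ i ω‖ ^ 2 ∂μ ≤ _
    simp only [hexp]
    rw [integral_const_mul, integral_finsetSum _ fun i _ => integrable_finsetSum _ fun j _ => hii i j]
    have hrow : ∀ i, ∫ ω, ∑ j, inner ℝ (ξ i ω) (ξ j ω) ∂μ ≤ σ ^ 2 := by
      intro i
      rw [integral_finsetSum _ fun j _ => hii i j,
        Finset.sum_eq_single i (fun j _ hj => hzero i j hj.symm) (by simp)]
      exact hdiag i
    calc _ ≤ (1 / (N : ℝ)) ^ 2 * ∑ _i : Fin N, σ ^ 2 := by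
          gcongr with i; exact hrow i
      _ = _ := by simp; field_simp

/-- The averaged representation step. -/
lemma integral_globalLoss_rep_step_le {L σ β : ℝ} (hN : 0 < N) (hL0 : 0 ≤ L) (hβ : 0 ≤ β)
    (hLβ : L * β ≤ 1) (hQ : Q.PartiallyDifferentiable) (hL : Q.LipschitzGradients L)
    (hS : S.IsIndependentSampling μ τ) (hU : S.Unbiased μ τ) (hV : S.BoundedVariance μ τ σ)
    (k : ℕ) {φ : Ω → Fin N → Vec a} {θ : Ω → Fin N → Vec b}
    (hφ : DeterminedBy (S.family τ) (past N τ k τ) φ)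
    (hθ : DeterminedBy (S.family τ) (past N τ k τ) θ) :
    ∫ ω, Q.globalLoss (avg (φ ω)
        - β • avg fun i => Q.batchGradRep i (S.repBatch i k ω) (φ ω i) (θ ω i)) (θ ω) ∂μ
      ≤ ∫ ω, Q.globalLoss (avg (φ ω)) (θ ω) ∂μ
        - β / 2 * ∫ ω, ‖Q.globalGradRep (avg (φ ω)) (θ ω)‖ ^ 2 ∂μ
        + β * L ^ 2 / 2 * ∫ ω, dispersion (φ ω) ∂μ + L * β ^ 2 * σ ^ 2 / (2 * N) := by
  have hnoise := integral_avg_noise hN hS hU hV hφ hθ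
  set g : Ω → Vec a := fun ω => avg fun i => Q.batchGradRep i (S.repBatch i k ω) (φ ω i) (θ ω i)
  set h : Ω → Vec a := fun ω => avg fun i => Q.gradRep i (φ ω i) (θ ω i)
  set ξ : Ω → Vec a := fun ω => avg fun i => Q.batchGradRep i (S.repBatch i k ω) (φ ω i) (θ ω i)
        - Q.gradRep i (φ ω i) (θ ω i)
  set v : Ω → Vec a := fun ω => Q.globalGradRep (avg (φ ω)) (θ ω)
  have hgξ : ∀ ω, g ω = h ω + ξ ω := fun ω => by
    have : g ω - h ω = ξ ω := avg_sub _ _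
    rw [← this]; abel
  have hd : DeterminedBy (S.family τ) (past N τ k τ) h :=
    hφ.comp₂ hθ fun p q => avg fun i => Q.gradRep i (p i) (q i)
  have vd : DeterminedBy (S.family τ) (past N τ k τ) v :=
    hφ.comp₂ hθ fun p q => Q.globalGradRep (avg p) q
  have sub : past N τ k τ ⊆ past N τ (k + 1) 0 := past_subset_succ
  have ξd : DeterminedBy (S.family τ) (past N τ (k + 1) 0) ξ := by
    have hB : DeterminedBy (S.family τ) (past N τ (k + 1) 0) fun ω i => S.repBatch i k ω := by
      intro ω ω' hω
      funext i
      exact hω _ (rep_mem_past i)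
    exact hB.comp₂ ((hφ.mono sub).comp₂ (hθ.mono sub) Prod.mk) fun B z =>
      avg fun i => Q.batchGradRep i (B i) (z.1 i) (z.2 i) - Q.gradRep i (z.1 i) (z.2 i)
  have gd : DeterminedBy (S.family τ) (past N τ (k + 1) 0) g := by
    rw [funext hgξ]
    exact (hd.mono sub).comp₂ ξd fun p q => p + q
  have xd : DeterminedBy (S.family τ) (past N τ (k + 1) 0) fun ω => avg (φ ω) :=
    (hφ.mono sub).comp avg
  have iF0 : Integrable (fun ω => Q.globalLoss (avg (φ ω)) (θ ω)) μ :=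
    (hφ.comp₂ hθ fun p q => Q.globalLoss (avg p) q).integrable hS.measurable
  have iF1 : Integrable (fun ω => Q.globalLoss (avg (φ ω) - β • g ω) (θ ω)) μ :=
    ((xd.comp₂ gd fun p q => p - β • q).comp₂ (hθ.mono sub) fun p q =>
      Q.globalLoss p q).integrable hS.measurable
  have ivξ : Integrable (fun ω => inner ℝ (v ω) (ξ ω)) μ :=
    ((vd.mono sub).comp₂ ξd fun p q => inner ℝ p q).integrable hS.measurable
  have ihξ : Integrable (fun ω => inner ℝ (h ω) (ξ ω)) μ :=
    ((hd.mono sub).comp₂ ξd fun p q => inner ℝ p q).integrable hS.measurable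
  have iξ : Integrable (fun ω => ‖ξ ω‖ ^ 2) μ := (ξd.comp fun p => ‖p‖ ^ 2).integrable hS.measurable
  have iv : Integrable (fun ω => ‖v ω‖ ^ 2) μ := (vd.comp fun p => ‖p‖ ^ 2).integrable hS.measurable
  have iD : Integrable (fun ω => dispersion (φ ω)) μ :=
    (hφ.comp fun p => dispersion p).integrable hS.measurable
  -- The noise products with `v` and `h` are kept exact, since they integrate to zero; bounding them
  -- pointwise would lose the speedup.
  have hpt : ∀ ω, Q.globalLoss (avg (φ ω) - β • g ω) (θ ω)
      + β / 2 * ‖v ω‖ ^ 2 + β * inner ℝ (v ω) (ξ ω)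
      ≤ Q.globalLoss (avg (φ ω)) (θ ω) + β * L ^ 2 / 2 * dispersion (φ ω)
        + L * β ^ 2 * inner ℝ (h ω) (ξ ω) + L * β ^ 2 / 2 * ‖ξ ω‖ ^ 2 := by
    intro ω
    have h1 := le_quadratic_of_lipschitz_gradient (hQ.globalLoss_rep (θ ω)) (L := L)
      (fun p q => by
        rw [hQ.gradient_globalLoss, hQ.gradient_globalLoss]
        exact hL.globalGradRep hN p q (θ ω)) (avg (φ ω)) (avg (φ ω) - β • g ω)
    rw [hQ.gradient_globalLoss, sub_sub_cancel_left, inner_neg_right, real_inner_smul_right,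
      norm_neg, norm_smul, mul_pow, Real.norm_eq_abs, sq_abs, hgξ ω, inner_add_right,
      norm_add_sq_real] at h1
    have h2 : ‖v ω - h ω‖ ^ 2 ≤ L ^ 2 * dispersion (φ ω) :=
      hL.norm_globalGradRep_sub_avg_sq_le (φ ω) (θ ω)
    rw [norm_sub_sq_real] at h2
    have h3 := mul_le_mul_of_nonneg_left h2 (by positivity : 0 ≤ β / 2)
    -- The quadratic term in `h` is cancelled by the `-β / 2 * ‖h ω‖ ^ 2` that polarization
    -- supplies.
    have h4 : L * β * (β / 2 * ‖h ω‖ ^ 2) ≤ 1 * (β / 2 * ‖h ω‖ ^ 2) := by gcongr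
    rw [hgξ ω]
    change Q.globalLoss (avg (φ ω) - β • (h ω + ξ ω)) (θ ω) ≤ Q.globalLoss (avg (φ ω)) (θ ω)
      + -(β * (inner ℝ (v ω) (h ω) + inner ℝ (v ω) (ξ ω)))
      + L / 2 * (β ^ 2 * (‖h ω‖ ^ 2 + 2 * inner ℝ (h ω) (ξ ω) + ‖ξ ω‖ ^ 2)) at h1
    linarith
  have i1 : Integrable (fun ω => Q.globalLoss (avg (φ ω) - β • g ω) (θ ω)
      + β / 2 * ‖v ω‖ ^ 2) μ := iF1.add (iv.const_mul _)
  have i2 : Integrable (fun ω => Q.globalLoss (avg (φ ω)) (θ ω)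
      + β * L ^ 2 / 2 * dispersion (φ ω)) μ := iF0.add (iD.const_mul _)
  have i3 : Integrable (fun ω => Q.globalLoss (avg (φ ω)) (θ ω)
      + β * L ^ 2 / 2 * dispersion (φ ω) + L * β ^ 2 * inner ℝ (h ω) (ξ ω)) μ :=
    i2.add (ihξ.const_mul _)
  have hmono := integral_mono (i1.add (ivξ.const_mul β)) (i3.add (iξ.const_mul (L * β ^ 2 / 2))) hpt
  simp only [Pi.add_apply] at hmono
  rw [integral_add i1 (ivξ.const_mul _), integral_add iF1 (iv.const_mul _),
    integral_add i3 (iξ.const_mul _), integral_add i2 (ihξ.const_mul _),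
    integral_add iF0 (iD.const_mul _)] at hmono
  simp only [integral_const_mul] at hmono
  rw [hnoise.1 v vd, hnoise.1 h hd] at hmono
  have h5 := mul_le_mul_of_nonneg_left hnoise.2 (by positivity : 0 ≤ L * β ^ 2 / 2)
  have h6 : L * β ^ 2 / 2 * (σ ^ 2 / N) = L * β ^ 2 * σ ^ 2 / (2 * N) := by ring
  linarith

/-- Spread of the stochastic gradients around the global gradient. -/
lemma integral_gradient_spread_le {L σ ς : ℝ} (hN : 0 < N) (hL : Q.LipschitzGradients L)
    (hS : S.IsIndependentSampling μ τ) (hV : S.BoundedVariance μ τ σ)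
    (hW : Q.BoundedVariability ς) (k : ℕ) {φ : Ω → Fin N → Vec a} {θ : Ω → Fin N → Vec b}
    (hφ : DeterminedBy (S.family τ) (past N τ k τ) φ)
    (hθ : DeterminedBy (S.family τ) (past N τ k τ) θ) :
    ∫ ω, (1 / (N : ℝ)) * ∑ i, ‖Q.batchGradRep i (S.repBatch i k ω) (φ ω i) (θ ω i)
        - Q.globalGradRep (avg (φ ω)) (θ ω)‖ ^ 2 ∂μ
      ≤ 3 * (σ ^ 2 + ς ^ 2 + L ^ 2 * ∫ ω, dispersion (φ ω) ∂μ) := by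
  have hN' : (0 : ℝ) < N := by positivity
  set n : Fin N → Ω → ℝ := fun i ω => ‖Q.batchGradRep i (S.repBatch i k ω) (φ ω i) (θ ω i)
    - Q.gradRep i (φ ω i) (θ ω i)‖ ^ 2 with hn
  have sub : past N τ k τ ⊆ past N τ (k + 1) 0 := past_subset_succ
  have hB : ∀ i, DeterminedBy (S.family τ) (past N τ (k + 1) 0) (S.repBatch i k) := fun i =>
    DeterminedBy.self (Y := S.family τ) (rep_mem_past i)
  have hφθ := (hφ.mono sub).comp₂ (hθ.mono sub) Prod.mk
  have ni : ∀ i, Integrable (n i) μ := fun i =>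
    ((hB i).comp₂ hφθ fun B z => ‖Q.batchGradRep i B (z.1 i) (z.2 i)
      - Q.gradRep i (z.1 i) (z.2 i)‖ ^ 2).integrable hS.measurable
  have hle : ∀ i, ∫ ω, n i ω ∂μ ≤ σ ^ 2 := fun i =>
    (hφ.comp₂ hθ Prod.mk).integral_le hS.measurable hS.indep (rep_notMem_past i)
      (fun z B => ‖Q.batchGradRep i B (z.1 i) (z.2 i) - Q.gradRep i (z.1 i) (z.2 i)‖ ^ 2)
      fun z => hV.1 i k (z.1 i) (z.2 i)
  have iD : Integrable (fun ω => dispersion (φ ω)) μ :=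
    (hφ.comp fun p => dispersion p).integrable hS.measurable
  have il : Integrable (fun ω => (1 / (N : ℝ)) * ∑ i, ‖Q.batchGradRep i (S.repBatch i k ω) (φ ω i)
      (θ ω i) - Q.globalGradRep (avg (φ ω)) (θ ω)‖ ^ 2) μ :=
    (integrable_finsetSum _ fun i _ => ((hB i).comp₂ hφθ fun B z =>
      ‖Q.batchGradRep i B (z.1 i) (z.2 i)
        - Q.globalGradRep (avg z.1) z.2‖ ^ 2).integrable hS.measurable).const_mul _
  have hpt : ∀ ω, (1 / (N : ℝ)) * ∑ i, ‖Q.batchGradRep i (S.repBatch i k ω) (φ ω i) (θ ω i)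
        - Q.globalGradRep (avg (φ ω)) (θ ω)‖ ^ 2
      ≤ 3 / (N : ℝ) * ∑ i, n i ω + (3 * L ^ 2 * dispersion (φ ω) + 3 * ς ^ 2) := by
    intro ω
    have h1 : ∀ i, ‖Q.batchGradRep i (S.repBatch i k ω) (φ ω i) (θ ω i)
        - Q.globalGradRep (avg (φ ω)) (θ ω)‖ ^ 2 ≤ 3 * (n i ω + L ^ 2 * ‖φ ω i - avg (φ ω)‖ ^ 2
          + ‖Q.gradRep i (avg (φ ω)) (θ ω i) - Q.globalGradRep (avg (φ ω)) (θ ω)‖ ^ 2) := by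
      intro i
      -- Split into sampling noise, disagreement between `φ ω i` and the mean, and heterogeneity of
      -- the workers at the common mean.
      have e := norm_add_three_sq_le
        (Q.batchGradRep i (S.repBatch i k ω) (φ ω i) (θ ω i) - Q.gradRep i (φ ω i) (θ ω i))
        (Q.gradRep i (φ ω i) (θ ω i) - Q.gradRep i (avg (φ ω)) (θ ω i))
        (Q.gradRep i (avg (φ ω)) (θ ω i) - Q.globalGradRep (avg (φ ω)) (θ ω))
      rw [sub_add_sub_cancel, sub_add_sub_cancel] at e
      have h := hL.1 i (φ ω i) (avg (φ ω)) (θ ω i) (θ ω i)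
      rw [sub_self, norm_zero, add_zero] at h
      have h2 := pow_le_pow_left₀ (norm_nonneg _) h 2
      rw [mul_pow] at h2
      simp only [hn]
      linarith
    have h2 := hW (avg (φ ω)) (θ ω)
    calc _ ≤ (1 / (N : ℝ)) * ∑ i, 3 * (n i ω + L ^ 2 * ‖φ ω i - avg (φ ω)‖ ^ 2
          + ‖Q.gradRep i (avg (φ ω)) (θ ω i) - Q.globalGradRep (avg (φ ω)) (θ ω)‖ ^ 2) :=
          mul_le_mul_of_nonneg_left (Finset.sum_le_sum fun i _ => h1 i) (by positivity)
      _ = 3 / (N : ℝ) * ∑ i, n i ω + (3 * L ^ 2 * dispersion (φ ω) + 3 * ((1 / (N : ℝ)) *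
          ∑ i, ‖Q.gradRep i (avg (φ ω)) (θ ω i) - Q.globalGradRep (avg (φ ω)) (θ ω)‖ ^ 2)) := by
          simp only [← Finset.mul_sum, Finset.sum_add_distrib, dispersion]; ring
      _ ≤ _ := by linarith
  have in' : Integrable (fun ω => ∑ i, n i ω) μ := integrable_finsetSum _ fun i _ => ni i
  have iD' : Integrable (fun ω => 3 * L ^ 2 * dispersion (φ ω) + 3 * ς ^ 2) μ :=
    (iD.const_mul _).add (integrable_const _)
  have hmono := integral_mono il ((in'.const_mul (3 / (N : ℝ))).add iD') hpt
  simp only [Pi.add_apply] at hmono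
  rw [integral_add (in'.const_mul _) iD', integral_const_mul (3 / (N : ℝ)), integral_finsetSum _ fun i _ => ni i,
    integral_add (iD.const_mul _) (integrable_const _), integral_const_mul (3 * L ^ 2)] at hmono
  have hs : 3 / (N : ℝ) * ∑ i, ∫ ω, n i ω ∂μ ≤ 3 * σ ^ 2 := by
    calc _ ≤ 3 / (N : ℝ) * ∑ _i : Fin N, σ ^ 2 :=
          mul_le_mul_of_nonneg_left (Finset.sum_le_sum fun i _ => hle i) (by positivity)
      _ = _ := by simp; field_simp
  simp only [integral_const, probReal_univ, one_smul] at hmono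
  linarith

end RepStep

/-! ### One round of the algorithm -/

section Iterates

variable {N a b : ℕ} {X Z W Y Ω : Type*} {Q : Problem N a b X Z W Y} {S : Batches Q Ω}
  {G : Digraph (Fin N)} {P : Matrix (Fin N) (Fin N) ℝ} {α β : ℝ} {τ : ℕ}
  {φ₀ : Vec a} {θ₀ : Fin N → Vec b}

lemma repAt_succ (k : ℕ) (ω : Ω) : repAt Q S G P α β τ φ₀ θ₀ (k + 1) ω
    = fun i => ∑ j ∈ neighbors G i, P i j • (repAt Q S G P α β τ φ₀ θ₀ k ω j
      - β • Q.batchGradRep j (S.repBatch j k ω) (repAt Q S G P α β τ φ₀ θ₀ k ω j)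
        (headAt Q S G P α β τ φ₀ θ₀ (k + 1) ω j)) := rfl

lemma meanRep_eq (k : ℕ) (ω : Ω) :
    meanRep Q S G P α β τ φ₀ θ₀ k ω = avg (repAt Q S G P α β τ φ₀ θ₀ k ω) := rfl

lemma meanRep_zero (hN : 0 < N) (ω : Ω) : meanRep Q S G P α β τ φ₀ θ₀ 0 ω = φ₀ := by
  have hN0 : (0 : ℝ) < N := by positivity
  simp only [meanRep, repAt, iterate, Finset.sum_const, Finset.card_univ, Fintype.card_fin,
    ← Nat.cast_smul_eq_nsmul ℝ, smul_smul]
  rw [one_div_mul_cancel hN0.ne', one_smul]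

/-- Unit column sums make mixing invisible to the mean, which therefore follows a plain averaged
stochastic gradient step. -/
lemma IsConsensusMatrix.meanRep_succ (hP : IsConsensusMatrix G P) (k : ℕ) (ω : Ω) :
    meanRep Q S G P α β τ φ₀ θ₀ (k + 1) ω = avg (repAt Q S G P α β τ φ₀ θ₀ k ω)
      - β • avg fun i => Q.batchGradRep i (S.repBatch i k ω) (repAt Q S G P α β τ φ₀ θ₀ k ω i)
        (headAt Q S G P α β τ φ₀ θ₀ (k + 1) ω i) := by
  rw [meanRep_eq, repAt_succ, avg_consensus hP, avg_sub_smul]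

lemma determinedBy_headAt_succ {k : ℕ}
    (hφ : DeterminedBy (S.family τ) (past N τ k 0) (repAt Q S G P α β τ φ₀ θ₀ k))
    (hθ : DeterminedBy (S.family τ) (past N τ k 0) (headAt Q S G P α β τ φ₀ θ₀ k)) :
    DeterminedBy (S.family τ) (past N τ k τ) (headAt Q S G P α β τ φ₀ θ₀ (k + 1)) :=
  DeterminedBy.pi fun i => (hφ.comp fun p => p i).headIterate (hθ.comp fun p => p i) le_rfl

lemma determinedBy_iterate (k : ℕ) :
    DeterminedBy (S.family τ) (past N τ k 0) (repAt Q S G P α β τ φ₀ θ₀ k) ∧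
    DeterminedBy (S.family τ) (past N τ k 0) (headAt Q S G P α β τ φ₀ θ₀ k) := by
  induction k with
  | zero => exact ⟨fun _ _ _ => rfl, fun _ _ _ => rfl⟩
  | succ k ih =>
    have hθ := (determinedBy_headAt_succ ih.1 ih.2).mono past_subset_succ
    have hφ := ih.1.mono (past_subset_succ (N := N))
    refine ⟨?_, hθ⟩
    have hB : DeterminedBy (S.family τ) (past N τ (k + 1) 0) fun ω i => S.repBatch i k ω :=
      fun ω ω' hω => funext fun i => hω _ (rep_mem_past i)
    exact hB.comp₂ (hφ.comp₂ hθ Prod.mk) fun B z i => ∑ j ∈ neighbors G i,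
      P i j • (z.1 j - β • Q.batchGradRep j (B j) (z.1 j) (z.2 j))

variable [MeasurableSpace Ω] {μ : Measure Ω} [IsProbabilityMeasure μ]

/-- Expected decrease of the global loss in one round. -/
lemma integral_globalLoss_succ_le {L σ : ℝ} (hN : 0 < N) (hL0 : 0 ≤ L) (hα : 0 ≤ α) (hβ : 0 ≤ β)
    (hτ : 1 ≤ τ) (hατ : L * (α * τ) ≤ 1 / 2) (hLβ : L * β ≤ 1) (hP : IsConsensusMatrix G P)
    (hQ : Q.PartiallyDifferentiable) (hL : Q.LipschitzGradients L)
    (hS : S.IsIndependentSampling μ τ) (hU : S.Unbiased μ τ) (hV : S.BoundedVariance μ τ σ)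
    (k : ℕ) :
    ∫ ω, Q.globalLoss (meanRep Q S G P α β τ φ₀ θ₀ (k + 1) ω)
        (headAt Q S G P α β τ φ₀ θ₀ (k + 1) ω) ∂μ
      ≤ ∫ ω, Q.globalLoss (meanRep Q S G P α β τ φ₀ θ₀ k ω) (headAt Q S G P α β τ φ₀ θ₀ k ω) ∂μ
        - β / 2 * ∫ ω, ‖Q.globalGradRep (meanRep Q S G P α β τ φ₀ θ₀ k ω)
            (headAt Q S G P α β τ φ₀ θ₀ (k + 1) ω)‖ ^ 2 ∂μ
        - α * τ / 4 * ∫ ω, ‖Q.globalGradHead (meanRep Q S G P α β τ φ₀ θ₀ k ω)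
            (headAt Q S G P α β τ φ₀ θ₀ k ω)‖ ^ 2 ∂μ
        + (β + α * τ) * L ^ 2 / 2 * ∫ ω, dispersion (repAt Q S G P α β τ φ₀ θ₀ k ω) ∂μ
        + (L * β ^ 2 * σ ^ 2 / (2 * N)
          + (L * α ^ 2 * τ / 2 + α ^ 3 * τ ^ 3 * L ^ 2 / 2) * σ ^ 2) := by
  have hN' : (0 : ℝ) < N := by positivity
  obtain ⟨hφ, hθ⟩ := determinedBy_iterate (Q := Q) (S := S) (G := G) (P := P) (α := α) (β := β)
    (τ := τ) (φ₀ := φ₀) (θ₀ := θ₀) k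
  have hθ' := determinedBy_headAt_succ hφ hθ
  have hφτ := hφ.mono (past_mono (N := N) (k := k) τ.zero_le)
  -- The two halves of the round meet at the loss with the old mean and the new heads, which
  -- explains the index `k + 1` in the first term of `measureM`.
  have hrep := integral_globalLoss_rep_step_le hN hL0 hβ hLβ hQ hL hS hU hV k hφτ hθ'
  simp only [← hP.meanRep_succ] at hrep
  simp only [← meanRep_eq] at hrep
  have hx : DeterminedBy (S.family τ) (past N τ k 0) (meanRep Q S G P α β τ φ₀ θ₀ k) :=
    hφ.comp avg
  have hhead := fun i => integral_localLoss_headIterate_le hα hL0 hτ hατ hQ hL hS hU hV i k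
    (hφ.comp fun p => p i) hx (hθ.comp fun p => p i)
  set x := meanRep Q S G P α β τ φ₀ θ₀ k
  set φ := repAt Q S G P α β τ φ₀ θ₀ k
  set θ := headAt Q S G P α β τ φ₀ θ₀ k
  set θ' := headAt Q S G P α β τ φ₀ θ₀ (k + 1)
  have e1 : ∫ ω, Q.globalLoss (x ω) (θ' ω) ∂μ
      = (1 / (N : ℝ)) * ∑ i, ∫ ω, Q.localLoss i (x ω) (θ' ω i) ∂μ := by
    simp only [Problem.globalLoss]
    rw [integral_const_mul, integral_finsetSum _ fun i _ =>
      (((hx.mono (past_mono τ.zero_le)).comp₂ hθ'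
        fun p q => Q.localLoss i p (q i)).integrable hS.measurable)]
  have e2 : ∫ ω, Q.globalLoss (x ω) (θ ω) ∂μ
      = (1 / (N : ℝ)) * ∑ i, ∫ ω, Q.localLoss i (x ω) (θ ω i) ∂μ := by
    simp only [Problem.globalLoss]
    rw [integral_const_mul, integral_finsetSum _ fun i _ => ((hx.comp₂ hθ
      fun p q => Q.localLoss i p (q i)).integrable hS.measurable)]
  have e3 : ∫ ω, dispersion (φ ω) ∂μ = (1 / (N : ℝ)) * ∑ i, ∫ ω, ‖φ ω i - x ω‖ ^ 2 ∂μ := by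
    simp only [dispersion]
    rw [integral_const_mul, integral_finsetSum _ fun i _ => ((hφ.comp
      fun p => ‖p i - avg p‖ ^ 2).integrable hS.measurable)]
    rfl
  have e4 : ∫ ω, ‖Q.globalGradHead (x ω) (θ ω)‖ ^ 2 ∂μ
      ≤ (1 / (N : ℝ)) * ∑ i, ∫ ω, ‖Q.gradHead i (x ω) (θ ω i)‖ ^ 2 ∂μ := by
    have hi : ∀ i, Integrable (fun ω => ‖Q.gradHead i (x ω) (θ ω i)‖ ^ 2) μ := fun i =>
      (hx.comp₂ hθ fun p q => ‖Q.gradHead i p (q i)‖ ^ 2).integrable hS.measurable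
    rw [← integral_finsetSum _ fun i _ => hi i, ← integral_const_mul]
    refine integral_mono ((hx.comp₂ hθ fun p q => ‖Q.globalGradHead p q‖ ^ 2).integrable
      hS.measurable) ((integrable_finsetSum _ fun i _ => hi i).const_mul _) fun ω => ?_
    exact norm_avg_sq_le _
  have hsum : (1 / (N : ℝ)) * ∑ i, ∫ ω, Q.localLoss i (x ω) (θ' ω i) ∂μ
      ≤ (1 / (N : ℝ)) * ∑ i, (∫ ω, Q.localLoss i (x ω) (θ ω i) ∂μ
        - α * τ / 4 * ∫ ω, ‖Q.gradHead i (x ω) (θ ω i)‖ ^ 2 ∂μ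
        + α * τ * L ^ 2 / 2 * ∫ ω, ‖φ ω i - x ω‖ ^ 2 ∂μ
        + (L * α ^ 2 * τ / 2 + α ^ 3 * τ ^ 3 * L ^ 2 / 2) * σ ^ 2) :=
    mul_le_mul_of_nonneg_left (Finset.sum_le_sum fun i _ => hhead i) (by positivity)
  rw [Finset.sum_add_distrib, Finset.sum_add_distrib, Finset.sum_sub_distrib, ← Finset.mul_sum,
    ← Finset.mul_sum, Finset.sum_const, Finset.card_univ, Fintype.card_fin, nsmul_eq_mul,
    mul_add, mul_add, mul_sub, ← e1, ← e2, mul_left_comm,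
    mul_left_comm (1 / (N : ℝ)) (α * τ * L ^ 2 / 2),
    ← e3, ← mul_assoc (1 / (N : ℝ)) (N : ℝ), one_div_mul_cancel hN'.ne', one_mul] at hsum
  have h5 := mul_le_mul_of_nonneg_left e4 (by positivity : 0 ≤ α * τ / 4)
  linarith

/-- Recursion for the expected dispersion. -/
lemma integral_dispersion_succ_le {L σ ς : ℝ} (hN : 2 ≤ N) (hG : StronglyConnected G)
    (hP : IsConsensusMatrix G P) (hL : Q.LipschitzGradients L)
    (hS : S.IsIndependentSampling μ τ) (hV : S.BoundedVariance μ τ σ)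
    (hW : Q.BoundedVariability ς) (k : ℕ) :
    ∫ ω, dispersion (repAt Q S G P α β τ φ₀ θ₀ (k + 1) ω) ∂μ
      ≤ (1 - gap P / 2) * ∫ ω, dispersion (repAt Q S G P α β τ φ₀ θ₀ k ω) ∂μ
        + 2 / gap P * β ^ 2 * (3 * (σ ^ 2 + ς ^ 2
          + L ^ 2 * ∫ ω, dispersion (repAt Q S G P α β τ φ₀ θ₀ k ω) ∂μ)) := by
  obtain ⟨hφ, hθ⟩ := determinedBy_iterate (Q := Q) (S := S) (G := G) (P := P) (α := α) (β := β)
    (τ := τ) (φ₀ := φ₀) (θ₀ := θ₀) k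
  have hφ1 := (determinedBy_iterate (Q := Q) (S := S) (G := G) (P := P) (α := α) (β := β)
    (τ := τ) (φ₀ := φ₀) (θ₀ := θ₀) (k + 1)).1
  have hθ' := determinedBy_headAt_succ hφ hθ
  have hd := hP.gap_pos (by omega)
  have hspread := integral_gradient_spread_le (by omega) hL hS hV hW k
    (hφ.mono (past_mono (N := N) (k := k) τ.zero_le)) hθ'
  have hB : DeterminedBy (S.family τ) (past N τ (k + 1) 0) fun ω i => S.repBatch i k ω :=
    fun ω ω' hω => funext fun i => hω _ (rep_mem_past i)
  have i1 := (hφ1.comp dispersion).integrable (μ := μ) hS.measurable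
  have i0 := (hφ.comp dispersion).integrable (μ := μ) hS.measurable
  have i2 := (hB.comp₂ ((hφ.mono past_subset_succ).comp₂ (hθ'.mono past_subset_succ) Prod.mk)
    fun B z => (1 / (N : ℝ)) * ∑ i, ‖Q.batchGradRep i (B i) (z.1 i) (z.2 i)
        - Q.globalGradRep (avg z.1) z.2‖ ^ 2).integrable (μ := μ) hS.measurable
  have hmono := integral_mono i1 ((i0.const_mul (1 - gap P / 2)).add
    (i2.const_mul (2 / gap P * β ^ 2))) fun ω => hP.dispersion_step_le hG hN
      (repAt Q S G P α β τ φ₀ θ₀ k ω) (fun j => Q.batchGradRep j (S.repBatch j k ω)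
        (repAt Q S G P α β τ φ₀ θ₀ k ω j) (headAt Q S G P α β τ φ₀ θ₀ (k + 1) ω j))
      (Q.globalGradRep (avg (repAt Q S G P α β τ φ₀ θ₀ k ω))
        (headAt Q S G P α β τ φ₀ θ₀ (k + 1) ω)) β
  simp only [Pi.add_apply] at hmono
  rw [integral_add (i0.const_mul _) (i2.const_mul _), integral_const_mul (1 - gap P / 2),
    integral_const_mul (2 / gap P * β ^ 2)] at hmono
  refine hmono.trans ?_
  gcongr

lemma integrable_measureM (hS : S.IsIndependentSampling μ τ) (k : ℕ) :
    Integrable (measureM Q S G P α β τ φ₀ θ₀ k) μ ∧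
    ∫ ω, measureM Q S G P α β τ φ₀ θ₀ k ω ∂μ
      = ∫ ω, ‖Q.globalGradRep (meanRep Q S G P α β τ φ₀ θ₀ k ω)
            (headAt Q S G P α β τ φ₀ θ₀ (k + 1) ω)‖ ^ 2 ∂μ
        + α * τ / β * ∫ ω, ‖Q.globalGradHead (meanRep Q S G P α β τ φ₀ θ₀ k ω)
            (headAt Q S G P α β τ φ₀ θ₀ k ω)‖ ^ 2 ∂μ
        + ∫ ω, dispersion (repAt Q S G P α β τ φ₀ θ₀ k ω) ∂μ := by
  obtain ⟨hφ, hθ⟩ := determinedBy_iterate (Q := Q) (S := S) (G := G) (P := P) (α := α) (β := β)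
    (τ := τ) (φ₀ := φ₀) (θ₀ := θ₀) k
  have hθ' := determinedBy_headAt_succ hφ hθ
  have iA : Integrable (fun ω => ‖Q.globalGradRep (meanRep Q S G P α β τ φ₀ θ₀ k ω)
      (headAt Q S G P α β τ φ₀ θ₀ (k + 1) ω)‖ ^ 2) μ :=
    ((hφ.mono (past_mono τ.zero_le)).comp₂ hθ'
      fun p q => ‖Q.globalGradRep (avg p) q‖ ^ 2).integrable hS.measurable
  have iB : Integrable (fun ω => ‖Q.globalGradHead (meanRep Q S G P α β τ φ₀ θ₀ k ω)
      (headAt Q S G P α β τ φ₀ θ₀ k ω)‖ ^ 2) μ :=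
    (hφ.comp₂ hθ fun p q => ‖Q.globalGradHead (avg p) q‖ ^ 2).integrable hS.measurable
  have iD : Integrable (fun ω => dispersion (repAt Q S G P α β τ φ₀ θ₀ k ω)) μ :=
    (hφ.comp dispersion).integrable hS.measurable
  have iAB : Integrable (fun ω => ‖Q.globalGradRep (meanRep Q S G P α β τ φ₀ θ₀ k ω)
      (headAt Q S G P α β τ φ₀ θ₀ (k + 1) ω)‖ ^ 2
      + α * τ / β * ‖Q.globalGradHead (meanRep Q S G P α β τ φ₀ θ₀ k ω)
      (headAt Q S G P α β τ φ₀ θ₀ k ω)‖ ^ 2) μ := iA.add (iB.const_mul _)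
  refine ⟨iAB.add iD, ?_⟩
  rw [← integral_const_mul, ← integral_add iA (iB.const_mul _), ← integral_add iAB iD]
  rfl

end Iterates

/-! ### Scalar recursions -/

section Bounds

/-- Telescoping a descent inequality perturbed by a bounded dispersion. -/
lemma sum_le_of_descent {f A B D : ℕ → ℝ} {K : ℕ} {β ρ L R Δ fStar M : ℝ} (hβ : 0 < β)
    (hρβ : ρ ≤ β) (hA : ∀ k, 0 ≤ A k) (hD0 : ∀ k, 0 ≤ D k) (hD : ∀ k, D k ≤ M)
    (hf : ∀ k, f (k + 1) ≤ f k - β / 2 * A k - ρ / 4 * B k + (β + ρ) * L ^ 2 / 2 * D k + R)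
    (hstar : fStar ≤ f K) (hΔ : f 0 - fStar ≤ Δ) :
    ∑ k ∈ Finset.range K, (A k + ρ / β * B k + D k)
      ≤ 4 / β * Δ + K * (4 / β * R + (4 * L ^ 2 + 1) * M) := by
  have hstep : ∀ k, A k + ρ / β * B k + D k
      ≤ 4 / β * (f k - f (k + 1)) + (4 / β * R + (4 * L ^ 2 + 1) * M) := by
    intro k
    have h1 : (β + ρ) * L ^ 2 / 2 * D k ≤ β * L ^ 2 * M := by
      calc _ ≤ (β + β) * L ^ 2 / 2 * D k := by
            have := hD0 k
            gcongr
        _ = β * L ^ 2 * D k := by ring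
        _ ≤ _ := by gcongr; exact hD k
    -- The coefficient of `A` is lowered from `β / 2` to `β / 4`, so that one factor `4 / β`
    -- produces the weights 1 and `ρ / β` of M(k).
    have h2 : β / 4 * A k + ρ / 4 * B k ≤ (f k - f (k + 1)) + R + β * L ^ 2 * M := by
      have := mul_nonneg hβ.le (hA k)
      linarith [hf k]
    have h3 := mul_le_mul_of_nonneg_left h2 (by positivity : 0 ≤ 4 / β)
    have e1 : 4 / β * (β / 4 * A k + ρ / 4 * B k) = A k + ρ / β * B k := by field_simp
    have e2 : 4 / β * ((f k - f (k + 1)) + R + β * L ^ 2 * M)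
        = 4 / β * (f k - f (k + 1)) + 4 / β * R + 4 * L ^ 2 * M := by field_simp
    rw [e1, e2] at h3
    linarith [hD k]
  calc _ ≤ ∑ k ∈ Finset.range K, (4 / β * (f k - f (k + 1))
        + (4 / β * R + (4 * L ^ 2 + 1) * M)) := Finset.sum_le_sum fun k _ => hstep k
    _ = 4 / β * (f 0 - f K) + K * (4 / β * R + (4 * L ^ 2 + 1) * M) := by
        rw [Finset.sum_add_distrib, ← Finset.mul_sum, Finset.sum_range_sub',
          Finset.sum_const, Finset.card_range, nsmul_eq_mul]
    _ ≤ _ := by gcongr; linarith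

/-- The perturbation `c` costs half of the contraction, leaving the factor `1 - d / 4`, and `4 * e /
d` is the fixed point of the resulting affine map. A sequence started at 0 never passes it. -/
lemma le_of_contraction {D : ℕ → ℝ} {d e c : ℝ} (hd : 0 < d) (hd1 : d ≤ 1) (hD0 : D 0 = 0)
    (he : 0 ≤ e) (hD : ∀ k, 0 ≤ D k) (hc : c ≤ d / 4)
    (hstep : ∀ k, D (k + 1) ≤ (1 - d / 2) * D k + (e + c * D k)) (k : ℕ) : D k ≤ 4 * e / d := by
  induction k with
  | zero => rw [hD0]; positivity
  | succ k ih =>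
    have h1 := mul_le_mul_of_nonneg_right hc (hD k)
    have h2 := mul_le_mul_of_nonneg_left ih (by linarith : 0 ≤ 1 - d / 4)
    have h3 : (1 - d / 4) * (4 * e / d) = 4 * e / d - e := by field_simp
    linarith [hstep k]

end Bounds

/-! ### Step sizes and assembly of the rate -/

/-- Consequences of the lower bound on the number `n` of rounds, in terms of square roots. -/
lemma step_size_bounds {N : ℕ} (hN : 2 ≤ N) {L ρ d n : ℝ} (hL : 0 < L) (hd : 0 < d)
    (hd1 : d ≤ 1 / 32) (hρ : 1 / d ^ 2 ≤ 32 * ρ) (hn : 18 * ρ ^ 2 * L ^ 2 * (N : ℝ) ^ 3 ≤ n) :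
    0 < n ∧ 2 * L ≤ √n ∧ 24 * (N / n) * L ^ 2 / d ^ 2 ≤ 1 ∧
      24 * (N / n) / d ^ 2 ≤ 192 / (L * (√N * √n)) := by
  have hN2 : (2 : ℝ) ≤ N := by exact_mod_cast hN
  have hρ32 : 32 ≤ ρ := by
    have : (1024 : ℝ) ≤ 1 / d ^ 2 := by
      rw [le_div_iff₀ (by positivity)]; nlinarith
    linarith
  have hn0 : 0 < n := lt_of_lt_of_le (by positivity) hn
  -- Square root of the lower bound on `n`, with 18 weakened to 16. Here `ρ` stands for C/(1-q).
  have hsn : 4 * ρ * L * N * √N ≤ √n := by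
    refine Real.le_sqrt_of_sq_le (le_trans ?_ hn)
    rw [mul_pow, Real.sq_sqrt (by positivity)]
    have : 0 ≤ ρ ^ 2 * L ^ 2 * (N : ℝ) ^ 3 := by positivity
    nlinarith
  have hsN : 1 ≤ √(N : ℝ) := Real.one_le_sqrt.2 (by linarith)
  have hkey : 24 * (N / n) / d ^ 2 ≤ 768 * ρ * N / n := by
    calc 24 * (N / n) / d ^ 2 = 24 * (N / n) * (1 / d ^ 2) := by ring
      _ ≤ 24 * (N / n) * (32 * ρ) := by gcongr
      _ = _ := by ring
  refine ⟨hn0, ?_, ?_, ?_⟩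
  · refine le_trans ?_ hsn
    calc 2 * L ≤ 4 * 32 * L * 2 * 1 := by linarith
      _ ≤ _ := by gcongr
  · calc 24 * (N / n) * L ^ 2 / d ^ 2 = 24 * (N / n) / d ^ 2 * L ^ 2 := by ring
      _ ≤ 768 * ρ * N / n * L ^ 2 := by gcongr
      _ = 768 * ρ * N * L ^ 2 / n := by ring
      _ ≤ 1 := by
        rw [div_le_one hn0]
        refine le_trans ?_ hn
        have h1 : 0 ≤ ρ * N * L ^ 2 := by positivity
        have h2 : (768 : ℝ) ≤ 18 * (ρ * (N : ℝ) ^ 2) := by nlinarith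
        nlinarith [mul_le_mul_of_nonneg_left h2 h1]
  · refine hkey.trans ?_
    have e : n = √n * √n := (Real.mul_self_sqrt hn0.le).symm
    have hsn0 : 0 < √n := Real.sqrt_pos.2 hn0
    rw [div_le_div_iff₀ hn0 (by positivity)]
    -- One factor `√n` of `n` pays for `ρ` and the powers of `N`; this removes the network from the
    -- final constant.
    calc 768 * ρ * N * (L * (√N * √n)) = 192 * ((4 * ρ * L * N * √N) * √n) := by ring
      _ ≤ 192 * (√n * √n) := by gcongr
      _ = 192 * n := by rw [← e]

/-- Since β = √(N/K) and ατ = 1/√K, multiplication by 4/β sends the averaged noise Lσ²/(2K) to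
2Lσ²/√(NK), the head noise Lσ²/(2τK) to 2Lσ²/(τ√(NK)), and the drift L²σ²/(2K√K) to 2L²σ²/(K√N).
Telescoping gives 4Δ/√(NK), and the dispersion is also of order 1/√(NK). -/
lemma averageM_le {L σ ς Δ : ℝ} (hL0 : 0 < L)
    {N a b : ℕ} {X Z W Y Ω : Type*} [MeasurableSpace Ω] {μ : Measure Ω} [IsProbabilityMeasure μ]
    {Q : Problem N a b X Z W Y} {S : Batches Q Ω} {G : Digraph (Fin N)}
    {P : Matrix (Fin N) (Fin N) ℝ} {τ K : ℕ} {φ₀ : Vec a} {θ₀ : Fin N → Vec b} {fStar : ℝ}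
    (hN : 2 ≤ N) (hτ : 1 ≤ τ) (hG : StronglyConnected G) (hP : IsConsensusMatrix G P)
    (hQ : Q.PartiallyDifferentiable) (hL : Q.LipschitzGradients L)
    (hS : S.IsIndependentSampling μ τ) (hU : S.Unbiased μ τ) (hV : S.BoundedVariance μ τ σ)
    (hW : Q.BoundedVariability ς) (hstar : ∀ φ θ, fStar ≤ Q.globalLoss φ θ)
    (hΔ : Q.globalLoss φ₀ θ₀ - fStar ≤ Δ)
    (hK : 18 * constC P ^ 2 * L ^ 2 * (N : ℝ) ^ 3 / (1 - constQ P) ^ 2 ≤ K)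
    (hK' : (N : ℝ) * L ^ 2 ≤ K) :
    averageM Q S G P (1 / (τ * √K)) (√(N / K)) τ φ₀ θ₀ μ K
      ≤ (4 * Δ + 2 * L * σ ^ 2 + (4 * L ^ 2 + 1) * (192 * (σ ^ 2 + ς ^ 2) / L))
          * (1 / √((N : ℝ) * K))
        + 2 * L ^ 2 * σ ^ 2 * (1 / (K * √N)) + 2 * L * σ ^ 2 * (1 / (τ * √((N : ℝ) * K))) := by
  have hN0 : (0 : ℝ) < N := by positivity
  have hτ0 : (0 : ℝ) < τ := by positivity
  have hd := hP.gap_pos (by omega : 0 < N)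
  have hd1 := hP.gap_le hG hN
  obtain ⟨hq, hC, hgap⟩ := hP.le_constC_div hG hN
  obtain ⟨hK0, hLK, hsmall, hbig⟩ := step_size_bounds hN hL0 hd hd1 hgap (n := K) (by
    refine le_trans (le_of_eq ?_) hK
    rw [div_pow]; ring)
  have hsK : 0 < √(K : ℝ) := Real.sqrt_pos.2 hK0
  have hsN : 0 < √(N : ℝ) := Real.sqrt_pos.2 hN0
  have eK : √(K : ℝ) ^ 2 = K := Real.sq_sqrt hK0.le
  have eN : √(N : ℝ) ^ 2 = N := Real.sq_sqrt hN0.le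
  have hsN1 : 1 ≤ √(N : ℝ) := Real.one_le_sqrt.2 (by exact_mod_cast (by omega : 1 ≤ N))
  set α : ℝ := 1 / (τ * √K) with hαdef
  set β : ℝ := √(N / K) with hβdef
  have hβ : β = √N / √K := Real.sqrt_div hN0.le _
  have hβ2 : β ^ 2 = N / K := Real.sq_sqrt (by positivity)
  have hβ0 : 0 < β := by rw [hβ]; positivity
  have hα0 : 0 < α := by positivity
  have hατ : α * τ = 1 / √K := by rw [hαdef]; field_simp
  have hρβ : α * τ ≤ β := by rw [hατ, hβ]; gcongr
  have hLατ : L * (α * τ) ≤ 1 / 2 := by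
    rw [hατ, mul_one_div, div_le_div_iff₀ hsK two_pos]; linarith
  have hLβ : L * β ≤ 1 := by
    rw [hβ, ← mul_div_assoc, div_le_one hsK]
    refine Real.le_sqrt_of_sq_le ?_
    rw [mul_pow, eN]; linarith
  have hdesc := integral_globalLoss_succ_le (φ₀ := φ₀) (θ₀ := θ₀) (by omega) hL0.le hα0.le hβ0.le
    hτ hLατ hLβ hP hQ hL hS hU hV
  have hdisp := integral_dispersion_succ_le (α := α) (β := β) (φ₀ := φ₀) (θ₀ := θ₀) hN hG hP hL hS
    hV hW
  set D : ℕ → ℝ := fun k => ∫ ω, dispersion (repAt Q S G P α β τ φ₀ θ₀ k ω) ∂μ with hDdef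
  have hD0 : ∀ k, 0 ≤ D k := fun k => integral_nonneg fun ω => dispersion_nonneg _
  -- The common starting point of all workers makes the initial dispersion vanish.
  have hDzero : D 0 = 0 := by
    have : ∀ ω, dispersion (repAt Q S G P α β τ φ₀ θ₀ 0 ω) = 0 := by
      intro ω
      have : avg (repAt Q S G P α β τ φ₀ θ₀ 0 ω) = φ₀ := meanRep_zero (by omega) ω
      simp [dispersion, this, repAt, iterate]
    simp [hDdef, this]
  have hDM : ∀ k, D k ≤ 192 * (σ ^ 2 + ς ^ 2) / L * (1 / √((N : ℝ) * K)) := by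
    intro k
    have h := le_of_contraction (D := D) (e := 6 * β ^ 2 * (σ ^ 2 + ς ^ 2) / gap P)
      (c := 6 * β ^ 2 * L ^ 2 / gap P) hd (by linarith) hDzero (by positivity) hD0 (by
        rw [hβ2, div_le_div_iff₀ hd (by norm_num)]
        rw [div_le_one (by positivity)] at hsmall
        linarith) (fun k => (hdisp k).trans (le_of_eq (by ring))) k
    refine h.trans ?_
    calc 4 * (6 * β ^ 2 * (σ ^ 2 + ς ^ 2) / gap P) / gap P
        = 24 * (N / K) / gap P ^ 2 * (σ ^ 2 + ς ^ 2) := by rw [hβ2]; ring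
      _ ≤ 192 / (L * (√N * √K)) * (σ ^ 2 + ς ^ 2) := by gcongr
      _ = _ := by rw [Real.sqrt_mul hN0.le]; field_simp
  have hsum := sum_le_of_descent (K := K) (fStar := fStar) (Δ := Δ) (D := D)
    (f := fun k => ∫ ω, Q.globalLoss (meanRep Q S G P α β τ φ₀ θ₀ k ω)
      (headAt Q S G P α β τ φ₀ θ₀ k ω) ∂μ) hβ0 hρβ
    (fun k => integral_nonneg fun ω => sq_nonneg _) hD0 hDM hdesc (by
      have hi : Integrable (fun ω => Q.globalLoss (meanRep Q S G P α β τ φ₀ θ₀ K ω)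
          (headAt Q S G P α β τ φ₀ θ₀ K ω)) μ := by
        obtain ⟨hφ, hθ⟩ := determinedBy_iterate (Q := Q) (S := S) (G := G) (P := P) (α := α)
          (β := β) (τ := τ) (φ₀ := φ₀) (θ₀ := θ₀) K
        exact (hφ.comp₂ hθ fun p q => Q.globalLoss (avg p) q).integrable hS.measurable
      calc fStar = ∫ _, fStar ∂μ := by simp
        _ ≤ _ := integral_mono (integrable_const _) hi fun ω => hstar _ _) (by
      have : ∀ ω, meanRep Q S G P α β τ φ₀ θ₀ 0 ω = φ₀ := meanRep_zero (by omega)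
      have h2 : ∀ ω, headAt Q S G P α β τ φ₀ θ₀ 0 ω = θ₀ := fun ω => rfl
      simp only [this, h2]
      simpa using hΔ)
  unfold averageM
  simp only [fun k => (integrable_measureM (Q := Q) (G := G) (P := P) (α := α) (β := β)
    (φ₀ := φ₀) (θ₀ := θ₀) hS k).2]
  calc _ ≤ 1 / (K : ℝ) * _ := mul_le_mul_of_nonneg_left hsum (by positivity)
    _ = _ := by
      rw [Real.sqrt_mul hN0.le, hβ, hαdef]
      rw [← eK, ← eN, Real.sqrt_sq hsN.le, Real.sqrt_sq hsK.le]
      field_simp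
      ring

end DePRL

end

theorem corollary1 (L σ ς Δ : ℝ) (hL : 0 < L) (hσ : 0 < σ) (hς : 0 < ς) :
    ∃ c : ℝ, 0 < c ∧
      ∀ (N a b : ℕ) (X Z W Y Ω : Type*) [MeasurableSpace Ω] (μ : MeasureTheory.Measure Ω)
        [MeasureTheory.IsProbabilityMeasure μ]
        (Q : DePRL.Problem N a b X Z W Y) (S : DePRL.Batches Q Ω)
        (G : Digraph (Fin N)) (P : Matrix (Fin N) (Fin N) ℝ) (τ K : ℕ)
        (φ₀ : DePRL.Vec a) (θ₀ : Fin N → DePRL.Vec b) (fStar : ℝ),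
        2 ≤ N → 1 ≤ τ →
        DePRL.StronglyConnected G →
        DePRL.IsConsensusMatrix G P →
        Q.PartiallyDifferentiable →
        Q.LipschitzGradients L →
        S.IsIndependentSampling μ τ →
        S.Unbiased μ τ →
        S.BoundedVariance μ τ σ →
        Q.BoundedVariability ς →
        IsGLB (Set.range fun x : DePRL.Vec a × (Fin N → DePRL.Vec b) => Q.globalLoss x.1 x.2)
          fStar →
        Q.globalLoss φ₀ θ₀ - fStar ≤ Δ →
        max (max (18 * DePRL.constC P ^ 2 * L ^ 2 * (N : ℝ) ^ 3 / (1 - DePRL.constQ P) ^ 2)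
            ((2 * L ^ 2 + 2) ^ 2 / ((N : ℝ) * L ^ 4))) ((N : ℝ) * L ^ 2) ≤ (K : ℝ) →
        let α : ℝ := 1 / ((τ : ℝ) * √(K : ℝ))
        let β : ℝ := √((N : ℝ) / (K : ℝ))
        (∀ k < K, MeasureTheory.Integrable (DePRL.measureM Q S G P α β τ φ₀ θ₀ k) μ) ∧
        DePRL.averageM Q S G P α β τ φ₀ θ₀ μ K ≤
          c * (1 / √((N : ℝ) * (K : ℝ)) + 1 / ((K : ℝ) * √(N : ℝ))
            + 1 / ((τ : ℝ) * √((N : ℝ) * (K : ℝ)))) ∧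
        DePRL.averageM Q S G P α β τ φ₀ θ₀ μ K ≤ 3 * c / √((N : ℝ) * (K : ℝ)) := by
  -- The absolute value ensures positivity of the constant, which is chosen before anything forces a
  -- sign on `Δ`.
  set c₁ : ℝ := 4 * |Δ| + 2 * L * σ ^ 2 + (4 * L ^ 2 + 1) * (192 * (σ ^ 2 + ς ^ 2) / L) with hc₁
  have hc₁0 : 0 < c₁ := by positivity
  refine ⟨c₁ + 2 * L ^ 2 * σ ^ 2, by positivity, ?_⟩
  intro N a b X Z W Y Ω _ μ _ Q S G P τ K φ₀ θ₀ fStar hN hτ hG hP hQ hLip hS hU hV hW hinf hΔ hK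
    α β
  have hN0 : (0 : ℝ) < N := by positivity
  have hτ1 : (1 : ℝ) ≤ τ := by exact_mod_cast hτ
  have hK1 := (le_max_left _ _).trans ((le_max_left _ _).trans hK)
  have hK3 := (le_max_right _ _).trans hK
  have hKpos : (0 : ℝ) < K := lt_of_lt_of_le (by positivity) hK3
  have hKone : (1 : ℝ) ≤ K := by exact_mod_cast Nat.cast_pos.1 hKpos
  have hmain := DePRL.averageM_le hL hN hτ hG hP hQ hLip hS hU hV hW
    (fun φ θ => hinf.1 ⟨(φ, θ), rfl⟩) (hΔ.trans (le_abs_self Δ)) hK1 hK3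
  have hsN : 0 < √(N : ℝ) := Real.sqrt_pos.2 hN0
  have hsK : 0 < √(K : ℝ) := Real.sqrt_pos.2 hKpos
  set u := 1 / √((N : ℝ) * (K : ℝ)) with hu
  set v := 1 / ((K : ℝ) * √(N : ℝ)) with hv
  set w := 1 / ((τ : ℝ) * √((N : ℝ) * (K : ℝ))) with hw
  have hu0 : 0 ≤ u := by positivity
  have hv0 : 0 ≤ v := by positivity
  have hw0 : 0 ≤ w := by positivity
  have hvu : v ≤ u := by
    rw [hv, hu, Real.sqrt_mul hN0.le]
    refine one_div_le_one_div_of_le (by positivity) ?_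
    rw [mul_comm]
    gcongr
    exact Real.sqrt_le_iff.2 ⟨by positivity, by nlinarith⟩
  have hwu : w ≤ u := by
    refine one_div_le_one_div_of_le (by positivity) ?_
    exact le_mul_of_one_le_left (by positivity) hτ1
  have hbound : DePRL.averageM Q S G P α β τ φ₀ θ₀ μ K
      ≤ (c₁ + 2 * L ^ 2 * σ ^ 2) * (u + v + w) := by
    refine hmain.trans ?_
    have h1 : 2 * L * σ ^ 2 ≤ c₁ := by
      have : 0 ≤ 4 * |Δ| + (4 * L ^ 2 + 1) * (192 * (σ ^ 2 + ς ^ 2) / L) := by positivity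
      linarith
    have h2 := mul_le_mul_of_nonneg_right h1 hw0
    -- These are exactly the unused products when the sum of the two constants multiplies `u + v +
    -- w`.
    have h3 : 0 ≤ 2 * L ^ 2 * σ ^ 2 * (u + w) + c₁ * v := by positivity
    linarith
  refine ⟨fun k _ => (DePRL.integrable_measureM hS k).1, hbound, hbound.trans ?_⟩
  calc (c₁ + 2 * L ^ 2 * σ ^ 2) * (u + v + w)
      ≤ (c₁ + 2 * L ^ 2 * σ ^ 2) * (u + u + u) := by gcongr
    _ = _ := by rw [hu]; ring
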